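/- For a complex matrix $M$ let $M^*$ be its conjugate transpose and $r(M)$ its rank, and for a Hermitian $M$ let $i_+(M)$ and $i_-(M)$ be the numbers of its positive and of its negative eigenvalues, counted with multiplicity. $[P, Q]$ denotes a row block matrix. Theorem. Let $A, B, C \in \mathbb{C}^{m\times m}$ with $A = A^*$, $C = C^*$, and assume that the equation $BXB^* = C$ has a Hermitian solution. Let $$M_1 = \begin{bmatrix} A & B \\ B^* & 0\end{bmatrix},\quad M_2 = \begin{bmatrix} BA & B^2 \\ B^* & 0\end{bmatrix},\quad M_3 = BAB^* - BC - CB^*,\quad \mathcal{S} = \{X \in \mathbb{C}^{m\times m} : X = X^*,\ BXB^* = C\}.$$ Then the following maxima and minima are attained and have the following values. (a) $\displaystyle\max_{X\in\mathcal S} r(A - BX - XB^*) = \min\{\, m + r[B^2,\ C - BA] - r(B),\ \ r(M_1),\ \ 2m - 2r(B) + r(M_3)\,\}.$ (b) $\displaystyle\min_{X\in\mathcal S} r(A - BX - XB^*) = \max\{s_1, s_2, s_3, s_4\}$, where $$\begin{aligned} s_1 &= 2r[B^2,\ C - BA] + r(M_1) - 2r(M_2),\\ s_2 &= 2r[B^2,\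 C - BA] + r(M_3) - 2r[B^2,\ BAB^* - CB^*],\\ s_3 &= 2r[B^2,\ C - BA] + i_+(M_1) - r(M_2) + i_-(M_3) - r[B^2,\ CB^* - BAB^*],\\ s_4 &= 2r[B^2,\ C - BA] + i_-(M_1) - r(M_2) + i_+(M_3) - r[B^2,\ CB^* - BAB^*]. \end{aligned}$$ (c) For each choice of sign, $\displaystyle\max_{X\in\mathcal S} i_\pm(A - BX - XB^*) = \min\{\, i_\pm(M_1),\ \ m - r(B) + i_\pm(M_3)\,\}.$ (d) For each choice of sign, $\displaystyle\min_{X\in\mathcal S} i_\pm(A - BX - XB^*) = r[B^2,\ C - BA] + \max\{\, i_\pm(M_1) - r(M_2),\ \ i_\pm(M_3) - r[B^2,\ CB^* - BAB^*]\,\}.$ -/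

import Mathlib

open scoped Matrix ComplexOrder

open scoped Classical in
/-- `i₊(A)`: the number of positive eigenvalues of a (Hermitian) matrix `A`, counted with
multiplicity, i.e. the number of positive roots of its characteristic polynomial. In the usual
order on `ℂ`, `0 < z` means that `z` is real and positive; all eigenvalues of a Hermitian matrix
are real. -/
noncomputable def posInertia {n : Type*} [Fintype n] [DecidableEq n] (A : Matrix n n ℂ) : ℕ :=
  A.charpoly.roots.countP (fun z => 0 < z)

open scoped Classical in
/-- `i₋(A)`: the number of negative eigenvalues of a (Hermitian) matrix `A`, counted with
multiplicity. -/
noncomputable def negInertia {n : Type*} [Fintype n] [DecidableEq n] (A : Matrix n n ℂ) : ℕ :=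
  A.charpoly.roots.countP (fun z => z < 0)

/-- The set of Hermitian solutions `X` of the matrix equation `B X B* = C`. -/
def hermitianSolutions {m : ℕ} (B C : Matrix (Fin m) (Fin m) ℂ) :
    Set (Matrix (Fin m) (Fin m) ℂ) :=
  {X | X.IsHermitian ∧ B * X * Bᴴ = C}

/-- The `2 × 2` block matrix `M₁ = [[A, B], [B*, 0]]`. -/
def blockM₁ {m : ℕ} (A B : Matrix (Fin m) (Fin m) ℂ) :
    Matrix (Fin m ⊕ Fin m) (Fin m ⊕ Fin m) ℂ :=
  Matrix.fromBlocks A B Bᴴ 0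

/-- The `2 × 2` block matrix `M₂ = [[B A, B²], [B*, 0]]`. -/
def blockM₂ {m : ℕ} (A B : Matrix (Fin m) (Fin m) ℂ) :
    Matrix (Fin m ⊕ Fin m) (Fin m ⊕ Fin m) ℂ :=
  Matrix.fromBlocks (B * A) (B ^ 2) Bᴴ 0

/-- The matrix `M₃ = B A B* - B C - C B*`. -/
def matM₃ {m : ℕ} (A B C : Matrix (Fin m) (Fin m) ℂ) : Matrix (Fin m) (Fin m) ℂ :=
  B * A * Bᴴ - B * C - C * Bᴴ

/-- The rank `r[P, Q]` of the row block matrix `[P, Q]`. -/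
noncomputable def rowBlockRank {m : ℕ} (P Q : Matrix (Fin m) (Fin m) ℂ) : ℕ :=
  (Matrix.fromCols P Q).rank

/-! ### Dimension counts -/

section Dimension

open Module

variable {V W : Type*} [AddCommGroup V] [Module ℂ V] [FiniteDimensional ℂ V]
  [AddCommGroup W] [Module ℂ W]

/-! Fix a solution X and put H = A − BX − XB*. Let F have range ker B. Every X − FZ* − ZF* is again
a solution, and it replaces H by H + BZF* + FZ*B* (`exists_mem_hermitianSolutions`). Put K₁ = ker
B*, K₂ = ker F* = ran B*, K₀ = K₁ ∩ K₂. The forms BZF* + FZ*B* are exactly the Hermitian forms that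
vanish on K₁ × K₁, on K₂ × K₂ and on K₀ × ℂᵐ (`hform_pert_of_mem_left` and its companions;
conversely `exists_pert_eq_of_vanish`). Hence only the values of H on these three sets matter.

The quantities of the theorem measure this data. With ⊥ taken with respect to H, i±(M₁) = r(B) +
i±(H|K₁), i±(M₃) = i±(H|K₂), r[B², C − BA] = r(B) − dim(K₀ ∩ ker H), r(M₂) = 2r(B) − dim(K₀ ∩ K₁^⊥),
r[B², CB* − BAB*] = r(B) − dim(K₀ ∩ K₂^⊥).

Bounds (`inertia_bounds`): restriction to Kᵢ lowers a partial index by at most codim Kᵢ; K₀ ∩ ker H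
lies in ker H; and the isotropic space K₀ ∩ Kᵢ^⊥ adds its dimension modulo ker H to the index of
H|Kᵢ (`posDim_add_finrank_le_posDim_add`).

Attainment. For the rank, take Z of maximal rank: if the kernel lies in both Kᵢ, in one, or in
neither, then the first bound holds with equality, the bound of that Kᵢ does, or a rank-two change
still raises the rank (`exists_rank_add_pert_ge`). For a maximal index, join optimal definite
subspaces of K₁ and K₂ and enlarge the result until it spans the whole space together with some Kᵢ
(`exists_posDim_add_pert_ge`). For the minima, write H on K₁ and on K₂ as signed sums of squares and
glue the squared functionals across K₀ (`exists_posDim_add_pert_le`). One Z serves both signs, so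
the minimal rank is the sum of the two minimal indices. -/

theorem finrank_map_add_finrank_inf_ker (f : V →ₗ[ℂ] W) (L : Submodule ℂ V) :
    finrank ℂ (L.map f) + finrank ℂ (L ⊓ LinearMap.ker f : Submodule ℂ V) = finrank ℂ L := by
  rw [← LinearMap.finrank_range_add_finrank_ker (f.domRestrict L), LinearMap.range_domRestrict,
    LinearMap.ker_domRestrict, ← Submodule.finrank_map_subtype_eq L,
    Submodule.map_comap_subtype]

theorem finrank_map_of_inf_ker_eq_bot (f : V →ₗ[ℂ] W) (L : Submodule ℂ V)
    (h : ∀ x ∈ L, f x = 0 → x = 0) : finrank ℂ (L.map f) = finrank ℂ L := by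
  have hb : L ⊓ LinearMap.ker f = ⊥ := by
    rw [eq_bot_iff]
    rintro x ⟨hx, hfx⟩
    exact h x hx hfx
  have := finrank_map_add_finrank_inf_ker f L
  rw [hb, finrank_bot] at this
  omega

theorem finrank_le_finrank_inf_ker_add [FiniteDimensional ℂ W] (f : V →ₗ[ℂ] W)
    (L : Submodule ℂ V) :
    finrank ℂ L ≤ finrank ℂ (L ⊓ LinearMap.ker f : Submodule ℂ V) + finrank ℂ W := by
  have h1 := finrank_map_add_finrank_inf_ker f L
  have h2 := Submodule.finrank_le (L.map f)
  omega

theorem finrank_comap_eq (f : V →ₗ[ℂ] W) (S : Submodule ℂ W) :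
    finrank ℂ (S.comap f) =
      finrank ℂ (LinearMap.ker f) + finrank ℂ (LinearMap.range f ⊓ S : Submodule ℂ W) := by
  have h := finrank_map_add_finrank_inf_ker f (S.comap f)
  rw [Submodule.map_comap_eq, inf_eq_right.2 (LinearMap.ker_le_comap f)] at h
  omega

theorem finrank_add_le_of_inf_eq_bot {P L K : Submodule ℂ V} (hP : P ≤ K) (hL : L ≤ K)
    (h : ∀ x ∈ P, x ∈ L → x = 0) : finrank ℂ P + finrank ℂ L ≤ finrank ℂ K := by
  have hb : P ⊓ L = ⊥ := by
    rw [eq_bot_iff]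
    rintro x ⟨hx, hfx⟩
    exact h x hx hfx
  have h1 := Submodule.finrank_sup_add_finrank_inf_eq P L
  rw [hb, finrank_bot] at h1
  have h2 := Submodule.finrank_mono (sup_le hP hL)
  omega

theorem sup_eq_of_finrank_le {P L K : Submodule ℂ V} (hP : P ≤ K) (hL : L ≤ K)
    (h : ∀ x ∈ P, x ∈ L → x = 0) (hd : finrank ℂ K ≤ finrank ℂ P + finrank ℂ L) :
    P ⊔ L = K := by
  have hb : P ⊓ L = ⊥ := by
    rw [eq_bot_iff]
    rintro x ⟨hx, hfx⟩
    exact h x hx hfx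
  have h1 := Submodule.finrank_sup_add_finrank_inf_eq P L
  rw [hb, finrank_bot] at h1
  exact Submodule.eq_of_le_of_finrank_le (sup_le hP hL) (by omega)

theorem exists_relative_compl {R L : Submodule ℂ V} (h : R ≤ L) :
    ∃ N ≤ L, (∀ x ∈ R, x ∈ N → x = 0) ∧ R ⊔ N = L ∧
      finrank ℂ R + finrank ℂ N = finrank ℂ L := by
  obtain ⟨C, hC⟩ := Submodule.exists_isCompl R
  have hN : R ⊔ L ⊓ C = L := by
    rw [inf_comm, ← sup_inf_assoc_of_le _ h, hC.sup_eq_top, top_inf_eq]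
  have hd : R ⊓ (L ⊓ C) = ⊥ := by
    rw [eq_bot_iff, ← hC.inf_eq_bot]
    exact inf_le_inf_left _ inf_le_right
  refine ⟨L ⊓ C, inf_le_left, fun x hx hx' => ?_, hN, ?_⟩
  · have : x ∈ R ⊓ (L ⊓ C) := ⟨hx, hx'⟩
    rwa [hd] at this
  · have h1 := Submodule.finrank_sup_add_finrank_inf_eq R (L ⊓ C)
    rw [hN, hd, finrank_bot] at h1
    omega

end Dimension

/-! ### The sesquilinear form of a matrix -/

section Form

open Module

variable {n : Type*} [Fintype n]

/-- The sesquilinear form `x* H y`. -/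
def hform (H : Matrix n n ℂ) (x y : n → ℂ) : ℂ := star x ⬝ᵥ H *ᵥ y

theorem hform_add_left (H : Matrix n n ℂ) (x y z : n → ℂ) :
    hform H (x + y) z = hform H x z + hform H y z := by
  simp [hform, add_dotProduct]

theorem hform_add_right (H : Matrix n n ℂ) (x y z : n → ℂ) :
    hform H x (y + z) = hform H x y + hform H x z := by
  simp [hform, Matrix.mulVec_add]

theorem hform_sub_left (H : Matrix n n ℂ) (x y z : n → ℂ) :
    hform H (x - y) z = hform H x z - hform H y z := by
  simp [hform, sub_dotProduct]

theorem hform_sub_right (H : Matrix n n ℂ) (x y z : n → ℂ) :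
    hform H x (y - z) = hform H x y - hform H x z := by
  simp [hform, Matrix.mulVec_sub]

theorem hform_smul_left (H : Matrix n n ℂ) (c : ℂ) (x y : n → ℂ) :
    hform H (c • x) y = star c * hform H x y := by
  simp [hform]

theorem hform_smul_right (H : Matrix n n ℂ) (c : ℂ) (x y : n → ℂ) :
    hform H x (c • y) = c * hform H x y := by
  simp [hform, Matrix.mulVec_smul]

@[simp] theorem hform_zero_left (H : Matrix n n ℂ) (y : n → ℂ) : hform H 0 y = 0 := by
  simp [hform]

@[simp] theorem hform_zero_right (H : Matrix n n ℂ) (x : n → ℂ) : hform H x 0 = 0 := by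
  simp [hform]

theorem hform_neg (H : Matrix n n ℂ) (x y : n → ℂ) : hform (-H) x y = -hform H x y := by
  simp [hform, Matrix.neg_mulVec]

theorem hform_matrix_add (H G : Matrix n n ℂ) (x y : n → ℂ) :
    hform (H + G) x y = hform H x y + hform G x y := by
  simp [hform, Matrix.add_mulVec]

theorem hform_sum_right {ι : Type*} (s : Finset ι) (H : Matrix n n ℂ) (x : n → ℂ)
    (y : ι → n → ℂ) : hform H x (∑ i ∈ s, y i) = ∑ i ∈ s, hform H x (y i) := by
  simp [hform, Matrix.mulVec_sum, dotProduct_sum]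

theorem hform_conj_mul {k : Type*} [Fintype k] (H : Matrix n n ℂ) (T : Matrix n k ℂ)
    (x y : k → ℂ) : hform (Tᴴ * H * T) x y = hform H (T *ᵥ x) (T *ᵥ y) := by
  simp only [hform, Matrix.star_mulVec, ← Matrix.mulVec_mulVec, Matrix.dotProduct_mulVec,
    Matrix.vecMul_vecMul]

theorem Matrix.IsHermitian.star_hform {H : Matrix n n ℂ} (hH : H.IsHermitian) (x y : n → ℂ) :
    star (hform H x y) = hform H y x := by
  rw [hform, Matrix.star_dotProduct, star_star, Matrix.star_mulVec, hH.eq, dotProduct_comm,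
    hform, Matrix.dotProduct_mulVec, dotProduct_comm]

theorem Matrix.IsHermitian.hform_eq_zero_comm {H : Matrix n n ℂ} (hH : H.IsHermitian)
    {x y : n → ℂ} : hform H x y = 0 ↔ hform H y x = 0 := by
  rw [← hH.star_hform x y, star_eq_zero]

theorem Matrix.IsHermitian.hform_self_im {H : Matrix n n ℂ} (hH : H.IsHermitian) (x : n → ℂ) :
    (hform H x x).im = 0 := by
  have := congrArg Complex.im (hH.star_hform x x)
  simp at this
  linarith

theorem hform_eq_zero_of_forall_left {H : Matrix n n ℂ} {y : n → ℂ}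
    (h : ∀ x, hform H x y = 0) : H *ᵥ y = 0 := by
  have := h (H *ᵥ y)
  rwa [hform, dotProduct_star_self_eq_zero] at this

/-- The vectors `y` with `x* H y = 0` for all `x ∈ K`. -/
def perp (H : Matrix n n ℂ) (K : Submodule ℂ (n → ℂ)) : Submodule ℂ (n → ℂ) where
  carrier := {y | ∀ x ∈ K, hform H x y = 0}
  add_mem' ha hb x hx := by rw [hform_add_right, ha x hx, hb x hx, add_zero]
  zero_mem' x _ := hform_zero_right H x
  smul_mem' c y hy x hx := by rw [hform_smul_right, hy x hx, mul_zero]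

theorem mem_perp {H : Matrix n n ℂ} {K : Submodule ℂ (n → ℂ)} {y : n → ℂ} :
    y ∈ perp H K ↔ ∀ x ∈ K, hform H x y = 0 := Iff.rfl

theorem perp_anti {H : Matrix n n ℂ} {K L : Submodule ℂ (n → ℂ)} (h : K ≤ L) :
    perp H L ≤ perp H K := fun _ hy x hx => hy x (h hx)

theorem perp_top (H : Matrix n n ℂ) : perp H ⊤ = LinearMap.ker H.mulVecLin := by
  ext y
  refine ⟨fun h => hform_eq_zero_of_forall_left fun x => h x trivial, fun h x _ => ?_⟩
  rw [hform, ← Matrix.mulVecLin_apply, LinearMap.mem_ker.1 h, dotProduct_zero]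

theorem perp_neg (H : Matrix n n ℂ) (K : Submodule ℂ (n → ℂ)) : perp (-H) K = perp H K := by
  ext y
  simp [mem_perp, hform_neg]

/-- `y ↦ x* H y` as a linear functional. -/
def hformRight (H : Matrix n n ℂ) (x : n → ℂ) : (n → ℂ) →ₗ[ℂ] ℂ where
  toFun y := hform H x y
  map_add' := hform_add_right H x
  map_smul' c y := hform_smul_right H c x y

@[simp] theorem hformRight_apply (H : Matrix n n ℂ) (x y : n → ℂ) :
    hformRight H x y = hform H x y := rfl

/-- Orthogonality to Q amounts to dim Q linear conditions, one for each basis vector. -/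
theorem finrank_le_finrank_inf_perp_add (H : Matrix n n ℂ) (K Q : Submodule ℂ (n → ℂ)) :
    finrank ℂ K ≤ finrank ℂ (K ⊓ perp H Q : Submodule ℂ (n → ℂ)) + finrank ℂ Q := by
  let b := finBasis ℂ Q
  let f : (n → ℂ) →ₗ[ℂ] (Fin (finrank ℂ Q) → ℂ) := LinearMap.pi fun i => hformRight H (b i : n → ℂ)
  have h := finrank_le_finrank_inf_ker_add f K
  rw [finrank_fin_fun] at h
  refine h.trans (Nat.add_le_add_right (Submodule.finrank_mono (inf_le_inf_left _ ?_)) _)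
  intro y hy x hx
  have hb : ∀ i, hform H (b i) y = 0 := fun i => congrFun (LinearMap.mem_ker.1 hy) i
  have hx' : x = ∑ i, (b.repr ⟨x, hx⟩ i) • (b i : n → ℂ) := by
    have := congrArg Q.subtype (b.sum_repr ⟨x, hx⟩)
    rw [map_sum] at this
    exact this.symm
  rw [hx', hform, star_sum, sum_dotProduct]
  refine Finset.sum_eq_zero fun i _ => ?_
  have := hform_smul_left H (b.repr ⟨x, hx⟩ i) (b i) y
  rw [hb, mul_zero] at this
  exact this

/-- Vectors of K in ker H impose no condition on K^⊥, so only a complement N of K ∩ ker H in K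
counts. -/
theorem finrank_add_finrank_inf_ker_le (H : Matrix n n ℂ) (hH : H.IsHermitian)
    (K : Submodule ℂ (n → ℂ)) :
    Fintype.card n + finrank ℂ (K ⊓ perp H ⊤ : Submodule ℂ (n → ℂ)) ≤
      finrank ℂ K + finrank ℂ (perp H K) := by
  obtain ⟨N, -, -, hN, hd⟩ := exists_relative_compl (inf_le_left : K ⊓ perp H ⊤ ≤ K)
  have h1 := finrank_le_finrank_inf_perp_add H ⊤ N
  rw [finrank_top, finrank_fintype_fun_eq_card, top_inf_eq] at h1
  have h2 : perp H N ≤ perp H K := by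
    intro y hy x hx
    rw [← hN] at hx
    obtain ⟨u, hu, v, hv, rfl⟩ := Submodule.mem_sup.1 hx
    rw [hform_add_left, hy v hv, hH.hform_eq_zero_comm.1 (hu.2 y trivial), add_zero]
  have h3 := Submodule.finrank_mono h2
  omega

end Form

/-! ### Positive definite subspaces -/

section Positive

open Module

variable {n : Type*} [Fintype n]

/-- The form of `H` is positive definite on `P`. -/
def PosOn (H : Matrix n n ℂ) (P : Submodule ℂ (n → ℂ)) : Prop :=
  ∀ x ∈ P, x ≠ 0 → 0 < (hform H x x).re

/-- The form of `H` is negative semidefinite on `P`. -/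
def NonposOn (H : Matrix n n ℂ) (P : Submodule ℂ (n → ℂ)) : Prop :=
  ∀ x ∈ P, (hform H x x).re ≤ 0

/-- The largest dimension of a subspace of `K` on which `H` is positive definite. -/
noncomputable def posDim (H : Matrix n n ℂ) (K : Submodule ℂ (n → ℂ)) : ℕ :=
  sSup {d | ∃ P ≤ K, PosOn H P ∧ finrank ℂ P = d}

theorem exists_finrank_eq_posDim (H : Matrix n n ℂ) (K : Submodule ℂ (n → ℂ)) :
    ∃ P ≤ K, PosOn H P ∧ finrank ℂ P = posDim H K := by
  refine Nat.sSup_mem (s := {d | ∃ P ≤ K, PosOn H P ∧ finrank ℂ P = d})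
    ⟨0, ⊥, bot_le, fun x hx h0 => absurd (by simpa using hx) h0, finrank_bot _ _⟩
    ⟨finrank ℂ K, ?_⟩
  rintro d ⟨P, hP, -, rfl⟩
  exact Submodule.finrank_mono hP

theorem finrank_le_posDim {H : Matrix n n ℂ} {K P : Submodule ℂ (n → ℂ)} (hP : P ≤ K)
    (h : PosOn H P) : finrank ℂ P ≤ posDim H K := by
  refine le_csSup ⟨finrank ℂ K, ?_⟩ ⟨P, hP, h, rfl⟩
  rintro d ⟨P, hP, -, rfl⟩
  exact Submodule.finrank_mono hP

theorem posDim_le {H : Matrix n n ℂ} {K : Submodule ℂ (n → ℂ)} {d : ℕ}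
    (h : ∀ P ≤ K, PosOn H P → finrank ℂ P ≤ d) : posDim H K ≤ d := by
  obtain ⟨P, hP, hpos, hd⟩ := exists_finrank_eq_posDim H K
  exact hd ▸ h P hP hpos

theorem posDim_congr {H G : Matrix n n ℂ} {K : Submodule ℂ (n → ℂ)}
    (h : ∀ x ∈ K, hform H x x = hform G x x) : posDim H K = posDim G K := by
  refine le_antisymm (posDim_le fun P hP hpos => finrank_le_posDim hP fun x hx h0 => ?_)
    (posDim_le fun P hP hpos => finrank_le_posDim hP fun x hx h0 => ?_)
  · rw [← h x (hP hx)]; exact hpos x hx h0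
  · rw [h x (hP hx)]; exact hpos x hx h0

theorem PosOn.finrank_add_le {H : Matrix n n ℂ} {P L K : Submodule ℂ (n → ℂ)} (h : PosOn H P)
    (hP : P ≤ K) (hL : L ≤ K) (hn : NonposOn H L) : finrank ℂ P + finrank ℂ L ≤ finrank ℂ K :=
  finrank_add_le_of_inf_eq_bot hP hL fun x hx hx' => by
    by_contra h0
    exact absurd (h x hx h0) (not_lt.2 (hn x hx'))

theorem posDim_add_finrank_le {H : Matrix n n ℂ} {L K : Submodule ℂ (n → ℂ)}
    (hL : L ≤ K) (hn : NonposOn H L) : posDim H K + finrank ℂ L ≤ finrank ℂ K := by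
  obtain ⟨P, hP, hpos, hd⟩ := exists_finrank_eq_posDim H K
  exact hd ▸ hpos.finrank_add_le hP hL hn

theorem PosOn.eq_zero_of_perp {H : Matrix n n ℂ} {P : Submodule ℂ (n → ℂ)} (h : PosOn H P)
    {x : n → ℂ} (hx : x ∈ P) (hx' : x ∈ perp H P) : x = 0 := by
  by_contra h0
  have := h x hx h0
  rw [hx' x hx] at this
  simp at this

theorem PosOn.sup_perp {H : Matrix n n ℂ} {P K : Submodule ℂ (n → ℂ)} (h : PosOn H P)
    (hP : P ≤ K) : P ⊔ K ⊓ perp H P = K := by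
  refine sup_eq_of_finrank_le hP inf_le_left (fun x hx hx' => h.eq_zero_of_perp hx hx'.2) ?_
  have := finrank_le_finrank_inf_perp_add H K P
  omega

theorem PosOn.sup {H : Matrix n n ℂ} (hH : H.IsHermitian) {P L : Submodule ℂ (n → ℂ)}
    (hP : PosOn H P) (hL : PosOn H L) (h : ∀ x ∈ P, ∀ y ∈ L, hform H x y = 0) :
    PosOn H (P ⊔ L) := by
  intro z hz h0
  obtain ⟨x, hx, y, hy, rfl⟩ := Submodule.mem_sup.1 hz
  have hxy := h x hx y hy
  have hyx := hH.hform_eq_zero_comm.1 hxy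
  rw [hform_add_left, hform_add_right, hform_add_right, hxy, hyx]
  simp only [add_zero, zero_add, Complex.add_re]
  by_cases hx0 : x = 0
  · subst hx0
    simpa using hL y hy (by simpa using h0)
  · by_cases hy0 : y = 0
    · subst hy0
      simpa using hP x hx hx0
    · exact add_pos (hP x hx hx0) (hL y hy hy0)

theorem posOn_span_singleton {H : Matrix n n ℂ} {x : n → ℂ} (hpos : 0 < (hform H x x).re) :
    PosOn H (ℂ ∙ x) := by
  intro z hz h0
  obtain ⟨c, rfl⟩ := Submodule.mem_span_singleton.1 hz
  have hc : c ≠ 0 := by rintro rfl; simp at h0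
  rw [hform_smul_left, hform_smul_right, ← mul_assoc]
  have : star c * c = (Complex.normSq c : ℂ) := by
    rw [mul_comm]; exact Complex.mul_conj c
  rw [this, Complex.re_ofReal_mul]
  exact mul_pos (Complex.normSq_pos.2 hc) hpos

/-- A definite Q ⊇ P of largest dimension has a nonpositive complement K ∩ Q^⊥, since a positive
vector there could be added to Q. This complement bounds every definite subspace of K, so Q is
optimal even among those that do not contain P. -/
theorem PosOn.exists_maximal {H : Matrix n n ℂ} (hH : H.IsHermitian)
    {P K : Submodule ℂ (n → ℂ)} (h : PosOn H P) (hP : P ≤ K) :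
    ∃ Q, P ≤ Q ∧ Q ≤ K ∧ PosOn H Q ∧ NonposOn H (K ⊓ perp H Q) ∧ finrank ℂ Q = posDim H K := by
  have hne : {d | ∃ Q, P ≤ Q ∧ Q ≤ K ∧ PosOn H Q ∧ finrank ℂ Q = d}.Nonempty :=
    ⟨_, P, le_rfl, hP, h, rfl⟩
  have hbd : BddAbove {d | ∃ Q, P ≤ Q ∧ Q ≤ K ∧ PosOn H Q ∧ finrank ℂ Q = d} := by
    refine ⟨finrank ℂ K, ?_⟩
    rintro d ⟨Q, -, hQ, -, rfl⟩
    exact Submodule.finrank_mono hQ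
  obtain ⟨Q, hPQ, hQK, hQ, hd⟩ := Nat.sSup_mem hne hbd
  have hnon : NonposOn H (K ⊓ perp H Q) := by
    rintro x ⟨hxK, hxQ⟩
    by_contra hpos
    rw [not_le] at hpos
    have hx0 : x ≠ 0 := by rintro rfl; simp at hpos
    have hspan : PosOn H (ℂ ∙ x) := posOn_span_singleton hpos
    have hsup : PosOn H (Q ⊔ ℂ ∙ x) := by
      refine hQ.sup hH hspan fun y hy z hz => ?_
      obtain ⟨c, rfl⟩ := Submodule.mem_span_singleton.1 hz
      rw [hform_smul_right, hxQ y hy, mul_zero]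
    have hle : finrank ℂ (Q ⊔ ℂ ∙ x : Submodule ℂ (n → ℂ)) ≤ finrank ℂ Q := by
      rw [hd]
      exact le_csSup hbd ⟨_, hPQ.trans le_sup_left,
        sup_le hQK ((Submodule.span_singleton_le_iff_mem _ _).2 hxK), hsup, rfl⟩
    have heq := Submodule.eq_of_le_of_finrank_le (le_sup_left : Q ≤ Q ⊔ ℂ ∙ x) hle
    have hxQ' : x ∈ Q := by
      rw [heq]
      exact Submodule.mem_sup_right (Submodule.mem_span_singleton_self x)
    exact hx0 (hQ.eq_zero_of_perp hxQ' hxQ)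
  refine ⟨Q, hPQ, hQK, hQ, hnon, le_antisymm (finrank_le_posDim hQK hQ) ?_⟩
  have h1 := posDim_add_finrank_le inf_le_left hnon
  have h2 := finrank_le_finrank_inf_perp_add H K Q
  omega

/-- The equality case of Cauchy–Schwarz: an isotropic vector of a semidefinite form lies in its
radical. Along y + twx, where w = x*Hy, the form is affine in t with slope 2|w|², so it cannot stay
nonpositive unless w = 0. -/
theorem NonposOn.hform_eq_zero {H : Matrix n n ℂ} (hH : H.IsHermitian)
    {L : Submodule ℂ (n → ℂ)} (h : NonposOn H L) {x y : n → ℂ} (hx : x ∈ L) (hy : y ∈ L)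
    (h0 : (hform H x x).re = 0) : hform H x y = 0 := by
  by_contra hne
  have hpos := Complex.normSq_pos.2 hne
  set w := hform H x y with hw
  have hyx : hform H y x = star w := (hH.star_hform x y).symm
  have hxx : hform H x x = 0 := Complex.ext h0 (hH.hform_self_im x)
  have key : ∀ t : ℝ, (hform H y y).re + 2 * t * Complex.normSq w ≤ 0 := by
    intro t
    have := h (y + ((t : ℂ) * w) • x) (L.add_mem hy (L.smul_mem _ hx))
    rw [hform_add_left, hform_add_right, hform_add_right, hform_smul_left, hform_smul_left,
      hform_smul_right, hform_smul_right, hxx, hyx, ← hw] at this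
    simp [Complex.normSq_apply] at this ⊢
    nlinarith [this]
  have h1 := key ((1 - (hform H y y).re) / (2 * Complex.normSq w))
  have h2 : 2 * ((1 - (hform H y y).re) / (2 * Complex.normSq w)) * Complex.normSq w
      = 1 - (hform H y y).re := by field_simp
  rw [h2] at h1
  linarith

/-- A totally isotropic `T`, orthogonal to `K'`, contributes to the positive index of any larger
space as many dimensions as it has modulo the radical. -/
theorem posDim_add_finrank_le_posDim_add {H : Matrix n n ℂ} (hH : H.IsHermitian)
    {T K' K : Submodule ℂ (n → ℂ)} (hT : T ≤ K') (hK : K' ≤ K) (hperp : T ≤ perp H K') :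
    posDim H K' + finrank ℂ T ≤
      posDim H K + finrank ℂ (T ⊓ perp H K : Submodule ℂ (n → ℂ)) := by
  obtain ⟨P, hP, hpos, hd⟩ := exists_finrank_eq_posDim H K'
  obtain ⟨Q, hPQ, hQK, hQ, hnon, hQd⟩ := hpos.exists_maximal hH (hP.trans hK)
  -- The gain of Q over P is at least dim(Q ∩ P^⊥). A vector t ∈ T orthogonal to Q ∩ P^⊥ is
  -- orthogonal to all of Q, because T ⊥ P. Being isotropic in the nonpositive space K ∩ Q^⊥, it is
  -- orthogonal to that space as well, hence to K. So dim T exceeds dim(T ∩ K^⊥) by at most the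
  -- gain.
  have h1 := finrank_le_finrank_inf_perp_add H T (Q ⊓ perp H P)
  have h2 := finrank_add_le_of_inf_eq_bot hPQ (inf_le_left : Q ⊓ perp H P ≤ Q)
    fun x hx hx' => hpos.eq_zero_of_perp hx hx'.2
  have h3 : T ⊓ perp H (Q ⊓ perp H P) ≤ T ⊓ perp H K := by
    rintro t ⟨htT, ht⟩
    refine ⟨htT, ?_⟩
    have htQ : t ∈ perp H Q := by
      intro q hq
      rw [← hpos.sup_perp hPQ] at hq
      obtain ⟨x, hx, y, hy, rfl⟩ := Submodule.mem_sup.1 hq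
      rw [hform_add_left, ht y hy, hperp htT x (hP hx), add_zero]
    have htt : (hform H t t).re = 0 := by rw [hperp htT t (hT htT)]; rfl
    intro k hk
    rw [← hQ.sup_perp hQK] at hk
    obtain ⟨x, hx, y, hy, rfl⟩ := Submodule.mem_sup.1 hk
    rw [hform_add_left, htQ x hx, hH.hform_eq_zero_comm.1
      (hnon.hform_eq_zero hH ⟨hK (hT htT), htQ⟩ hy htt), add_zero]
  have h4 := Submodule.finrank_mono h3
  omega

/-- P is an optimal definite subspace and N a complement of the radical inside the nonpositive space
K ∩ P^⊥. A vector of N with x*Hx = 0 would lie in the radical, so N is negative definite. -/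
theorem exists_signature_decomposition {H : Matrix n n ℂ} (hH : H.IsHermitian)
    (K : Submodule ℂ (n → ℂ)) :
    ∃ P N, P ≤ K ∧ N ≤ K ∧ PosOn H P ∧ PosOn (-H) N ∧ N ≤ perp H P ∧ P ⊔ (K ⊓ perp H K ⊔ N) = K ∧
      finrank ℂ K ≤ finrank ℂ P + (finrank ℂ (K ⊓ perp H K : Submodule ℂ (n → ℂ)) +
        finrank ℂ N) := by
  obtain ⟨Q, -, hQK, hQ, hnon, -⟩ := PosOn.exists_maximal hH (P := ⊥) (K := K)
    (fun x hx h0 => absurd (by simpa using hx) h0) bot_le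
  have hR : K ⊓ perp H K ≤ K ⊓ perp H Q := inf_le_inf_left _ (perp_anti hQK)
  obtain ⟨N, hN, hdis, hsup, hd⟩ := exists_relative_compl hR
  refine ⟨Q, N, hQK, hN.trans inf_le_left, hQ, fun x hx h0 => ?_, hN.trans inf_le_right, ?_, ?_⟩
  · rw [hform_neg, Complex.neg_re, neg_pos]
    refine lt_of_le_of_ne (hnon x (hN hx)) fun hzero => h0 (hdis x ⟨(hN hx).1, ?_⟩ hx)
    intro k hk
    rw [← hQ.sup_perp hQK] at hk
    obtain ⟨y, hy, z, hz, rfl⟩ := Submodule.mem_sup.1 hk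
    rw [hform_add_left, (hN hx).2 y hy,
      hH.hform_eq_zero_comm.1 (hnon.hform_eq_zero hH (hN hx) hz hzero), add_zero]
  · rw [hsup, hQ.sup_perp hQK]
  · have h2 := finrank_le_finrank_inf_perp_add H K Q
    omega

/-- Sylvester's law of inertia on a subspace. -/
theorem posDim_add_posDim_neg_add_finrank_radical {H : Matrix n n ℂ} (hH : H.IsHermitian)
    (K : Submodule ℂ (n → ℂ)) :
    posDim H K + posDim (-H) K + finrank ℂ (K ⊓ perp H K : Submodule ℂ (n → ℂ)) =
      finrank ℂ K := by
  apply le_antisymm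
  · obtain ⟨N, hN, hneg, hd⟩ := exists_finrank_eq_posDim (-H) K
    have hdis : ∀ x ∈ N, x ∈ K ⊓ perp H K → x = 0 := fun x hx hx' =>
      hneg.eq_zero_of_perp hx (by rw [perp_neg]; exact perp_anti hN hx'.2)
    have h1 := finrank_add_le_of_inf_eq_bot (K := N ⊔ K ⊓ perp H K) le_sup_left le_sup_right hdis
    have hnon : NonposOn H (N ⊔ K ⊓ perp H K) := by
      intro z hz
      obtain ⟨x, hx, y, hy, rfl⟩ := Submodule.mem_sup.1 hz
      have hxy : hform H x y = 0 := hy.2 x (hN hx)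
      rw [hform_add_left, hform_add_right, hform_add_right, hxy, hH.hform_eq_zero_comm.1 hxy,
        hy.2 y hy.1]
      by_cases hx0 : x = 0
      · simp [hx0]
      · have := hneg x hx hx0
        rw [hform_neg] at this
        simp at this ⊢
        exact this.le
    have h2 := posDim_add_finrank_le (sup_le hN inf_le_left) hnon
    omega
  · obtain ⟨P, N, hP, hN, hpos, hneg, -, -, hd⟩ := exists_signature_decomposition hH K
    have h1 := finrank_le_posDim hP hpos
    have h2 := finrank_le_posDim hN hneg
    omega

theorem finrank_ker_mulVecLin_add_rank {m : Type*} [Fintype m] (A : Matrix m n ℂ) :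
    finrank ℂ (LinearMap.ker A.mulVecLin) + A.rank = Fintype.card n := by
  have := LinearMap.finrank_range_add_finrank_ker A.mulVecLin
  rw [finrank_fintype_fun_eq_card] at this
  rw [Matrix.rank]
  omega

theorem rank_eq_posDim_add {H : Matrix n n ℂ} (hH : H.IsHermitian) :
    H.rank = posDim H ⊤ + posDim (-H) ⊤ := by
  have h1 := posDim_add_posDim_neg_add_finrank_radical hH ⊤
  rw [top_inf_eq, perp_top, finrank_top, finrank_fintype_fun_eq_card] at h1
  have h2 := finrank_ker_mulVecLin_add_rank H
  omega

end Positive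

/-! ### Factorisations and perturbations -/

section Perturbation

open Module

/-- The projection onto K is taken along a complement that contains a complement N of K ∩ L in L.
This makes L invariant. -/
theorem exists_projection_map_le {V : Type*} [AddCommGroup V] [Module ℂ V]
    [FiniteDimensional ℂ V] (K L : Submodule ℂ V) :
    ∃ π : V →ₗ[ℂ] V, (∀ x, π x ∈ K) ∧ (∀ x ∈ K, π x = x) ∧ ∀ x ∈ L, π x ∈ L := by
  obtain ⟨N, hN, hdis, hsup, -⟩ := exists_relative_compl (inf_le_right : K ⊓ L ≤ L)
  obtain ⟨C, hC⟩ := Submodule.exists_isCompl (K ⊔ N)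
  have hKN : Disjoint K N := by
    rw [Submodule.disjoint_def]
    exact fun x hx hx' => hdis x ⟨hx, hN hx'⟩ hx'
  have hcompl : IsCompl K (N ⊔ C) :=
    ⟨hKN.disjoint_sup_right_of_disjoint_sup_left hC.disjoint,
      codisjoint_iff.2 (by rw [← sup_assoc, hC.sup_eq_top])⟩
  refine ⟨K.projection (N ⊔ C) hcompl, fun x => Submodule.projection_apply_mem hcompl x,
    fun x hx => Submodule.projection_apply_of_mem_left hcompl hx, fun x hx => ?_⟩
  rw [← hsup] at hx
  obtain ⟨u, hu, v, hv, rfl⟩ := Submodule.mem_sup.1 hx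
  rw [map_add, Submodule.projection_apply_of_mem_left hcompl hu.1,
    (Submodule.projection_apply_eq_zero_iff hcompl).2 (Submodule.mem_sup_left hv), add_zero]
  exact hu.2

variable {n p q : Type*} [Fintype n] [Fintype p] [Fintype q]

theorem exists_mul_mul_self_eq [DecidableEq n] [DecidableEq p] (A : Matrix p n ℂ) :
    ∃ G : Matrix n p ℂ, A * G * A = A := by
  obtain ⟨s, hs⟩ := A.mulVecLin.rangeRestrict.exists_rightInverse_of_surjective
    A.mulVecLin.range_rangeRestrict
  obtain ⟨g, hg⟩ := LinearMap.exists_extend s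
  refine ⟨LinearMap.toMatrix' g, ?_⟩
  refine Matrix.toLin'.injective (LinearMap.ext fun x => ?_)
  have h1 : g (A *ᵥ x) = s (A.mulVecLin.rangeRestrict x) := by
    rw [← hg]; rfl
  have h2 := congrArg Subtype.val (LinearMap.congr_fun hs (A.mulVecLin.rangeRestrict x))
  simp only [Matrix.toLin'_apply, ← Matrix.mulVec_mulVec, LinearMap.toMatrix'_mulVec, h1]
  exact h2

/-- The left kernel `{x | B* x = 0}`. -/
def leftKer (B : Matrix n p ℂ) : Submodule ℂ (n → ℂ) := LinearMap.ker Bᴴ.mulVecLin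

omit [Fintype p] in
theorem mem_leftKer {B : Matrix n p ℂ} {x : n → ℂ} : x ∈ leftKer B ↔ Bᴴ *ᵥ x = 0 := Iff.rfl

theorem exists_eq_mul_of_leftKer_le {k : Type*} [Fintype k] (F : Matrix n q ℂ) (Ψ : Matrix k n ℂ)
    (h : ∀ x ∈ leftKer F, Ψ *ᵥ x = 0) : ∃ Y : Matrix k q ℂ, Ψ = Y * Fᴴ := by
  classical
  obtain ⟨G, hG⟩ := exists_mul_mul_self_eq Fᴴ
  refine ⟨Ψ * G, Matrix.toLin'.injective (LinearMap.ext fun x => ?_)⟩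
  have h1 := h (x - G *ᵥ Fᴴ *ᵥ x) (by
    rw [mem_leftKer, Matrix.mulVec_sub, Matrix.mulVec_mulVec, Matrix.mulVec_mulVec,
      hG, sub_self])
  rw [Matrix.mulVec_sub, sub_eq_zero] at h1
  simpa only [Matrix.toLin'_apply, ← Matrix.mulVec_mulVec] using h1

/-- The perturbation `B Z F* + F Z* B*`. -/
def pert (B : Matrix n p ℂ) (F : Matrix n q ℂ) (Z : Matrix p q ℂ) : Matrix n n ℂ :=
  B * Z * Fᴴ + F * Zᴴ * Bᴴ

omit [Fintype n] in
theorem pert_isHermitian (B : Matrix n p ℂ) (F : Matrix n q ℂ) (Z : Matrix p q ℂ) :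
    (pert B F Z).IsHermitian := by
  simp only [Matrix.IsHermitian, pert, Matrix.conjTranspose_add, Matrix.conjTranspose_mul,
    Matrix.conjTranspose_conjTranspose, Matrix.mul_assoc]
  rw [add_comm]

omit [Fintype n] in
theorem pert_add (B : Matrix n p ℂ) (F : Matrix n q ℂ) (Z Z' : Matrix p q ℂ) :
    pert B F (Z + Z') = pert B F Z + pert B F Z' := by
  simp only [pert, Matrix.conjTranspose_add, Matrix.mul_add, Matrix.add_mul]
  abel

omit [Fintype n] in
theorem pert_neg (B : Matrix n p ℂ) (F : Matrix n q ℂ) (Z : Matrix p q ℂ) :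
    pert B F (-Z) = -pert B F Z := by
  simp only [pert, Matrix.conjTranspose_neg, Matrix.mul_neg, Matrix.neg_mul]
  abel

omit [Fintype n] in
theorem pert_swap (B : Matrix n p ℂ) (F : Matrix n q ℂ) (Z : Matrix p q ℂ) :
    pert F B Zᴴ = pert B F Z := by
  simp only [pert, Matrix.conjTranspose_conjTranspose]
  rw [add_comm]

theorem hform_pert (B : Matrix n p ℂ) (F : Matrix n q ℂ) (Z : Matrix p q ℂ) (x y : n → ℂ) :
    hform (pert B F Z) x y = star (Bᴴ *ᵥ x) ⬝ᵥ Z *ᵥ (Fᴴ *ᵥ y) +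
      star (Fᴴ *ᵥ x) ⬝ᵥ Zᴴ *ᵥ (Bᴴ *ᵥ y) := by
  rw [pert, hform_matrix_add]
  simp only [hform, Matrix.star_mulVec, ← Matrix.mulVec_mulVec, Matrix.dotProduct_mulVec,
    Matrix.vecMul_vecMul, Matrix.conjTranspose_conjTranspose]

theorem hform_pert_of_mem_left {B : Matrix n p ℂ} {F : Matrix n q ℂ} (Z : Matrix p q ℂ)
    {x y : n → ℂ} (hx : x ∈ leftKer B) (hy : y ∈ leftKer B) : hform (pert B F Z) x y = 0 := by
  rw [hform_pert, mem_leftKer.1 hx, mem_leftKer.1 hy]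
  simp

theorem hform_pert_of_mem_right {B : Matrix n p ℂ} {F : Matrix n q ℂ} (Z : Matrix p q ℂ)
    {x y : n → ℂ} (hx : x ∈ leftKer F) (hy : y ∈ leftKer F) : hform (pert B F Z) x y = 0 := by
  rw [hform_pert, mem_leftKer.1 hx, mem_leftKer.1 hy]
  simp

theorem hform_pert_of_mem_inf {B : Matrix n p ℂ} {F : Matrix n q ℂ} (Z : Matrix p q ℂ)
    {x y : n → ℂ} (hx : x ∈ leftKer B ⊓ leftKer F) : hform (pert B F Z) x y = 0 := by
  rw [hform_pert, mem_leftKer.1 hx.1, mem_leftKer.1 hx.2]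
  simp

/-- The hypotheses say that Ψ factors through B on the left and through F* on the right. A
generalised inverse of F* merges the two factorisations into Ψ = BZF*. -/
theorem exists_pert_eq (B : Matrix n p ℂ) (F : Matrix n q ℂ) (Ψ : Matrix n n ℂ)
    (hB : ∀ x ∈ leftKer B, Ψᴴ *ᵥ x = 0) (hF : ∀ x ∈ leftKer F, Ψ *ᵥ x = 0) :
    ∃ Z : Matrix p q ℂ, pert B F Z = Ψ + Ψᴴ := by
  classical
  obtain ⟨Y, hY⟩ := exists_eq_mul_of_leftKer_le F Ψ hF
  obtain ⟨Y', hY'⟩ := exists_eq_mul_of_leftKer_le B Ψᴴ hB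
  obtain ⟨G, hG⟩ := exists_mul_mul_self_eq Fᴴ
  have h1 : Ψ = B * Y'ᴴ := by
    have := congrArg Matrix.conjTranspose hY'
    simpa using this
  have h2 : Ψ = B * (Y'ᴴ * G) * Fᴴ := by
    rw [← Matrix.mul_assoc, ← h1, hY, Matrix.mul_assoc Y, Matrix.mul_assoc Y, hG]
  refine ⟨Y'ᴴ * G, ?_⟩
  have h3 : Ψᴴ = F * (Y'ᴴ * G)ᴴ * Bᴴ := by
    conv_lhs => rw [h2]
    simp only [Matrix.conjTranspose_mul, Matrix.conjTranspose_conjTranspose, Matrix.mul_assoc]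
  rw [pert, ← h2, ← h3]

theorem hform_conjTranspose (Ψ : Matrix n n ℂ) (x y : n → ℂ) :
    hform Ψᴴ x y = star (hform Ψ y x) := by
  rw [hform, hform, Matrix.star_dotProduct, Matrix.star_mulVec, Matrix.conjTranspose_conjTranspose,
    Matrix.dotProduct_mulVec]

theorem exists_dotProduct_eq (f : (n → ℂ) →ₗ[ℂ] ℂ) : ∃ a : n → ℂ, ∀ x, f x = a ⬝ᵥ x := by
  classical
  exact ⟨(dotProductEquiv ℂ n).symm f, fun x => by
    rw [← dotProductEquiv_apply_apply, LinearEquiv.apply_symm_apply]⟩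

/-- These perturbations of rank at most two, one for each pair of functionals with f = 0 on ker B*
and g = 0 on ker F*, are the tool for raising the rank or the index one step at a time. -/
theorem exists_pert_hform_functionals (B : Matrix n p ℂ) (F : Matrix n q ℂ)
    (f g : (n → ℂ) →ₗ[ℂ] ℂ) (hf : leftKer B ≤ LinearMap.ker f) (hg : leftKer F ≤ LinearMap.ker g) :
    ∃ Z : Matrix p q ℂ, ∀ x y,
      hform (pert B F Z) x y = star (f x) * g y + star (g x) * f y := by
  classical
  obtain ⟨a, ha⟩ := exists_dotProduct_eq f
  obtain ⟨b, hb⟩ := exists_dotProduct_eq g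
  have hΨ : ∀ y, Matrix.vecMulVec (star a) b *ᵥ y = g y • star a := fun y => by
    rw [Matrix.vecMulVec_mulVec, hb]
    ext i; simp [mul_comm]
  have hΨ' : ∀ y, (Matrix.vecMulVec (star a) b)ᴴ *ᵥ y = f y • star b := fun y => by
    rw [Matrix.conjTranspose_vecMulVec, star_star, Matrix.vecMulVec_mulVec, ha]
    ext i; simp [mul_comm]
  obtain ⟨Z, hZ⟩ := exists_pert_eq B F (Matrix.vecMulVec (star a) b)
    (fun x hx => by rw [hΨ', LinearMap.mem_ker.1 (hf hx), zero_smul])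
    (fun x hx => by rw [hΨ, LinearMap.mem_ker.1 (hg hx), zero_smul])
  refine ⟨Z, fun x y => ?_⟩
  have hstar : ∀ (c x : n → ℂ), star x ⬝ᵥ star c = star (c ⬝ᵥ x) := fun c x => by
    rw [Matrix.star_dotProduct_star, dotProduct_comm]
  rw [hZ, hform_matrix_add, hform, hform, hΨ, hΨ', dotProduct_smul, dotProduct_smul, hstar, hstar,
    ← ha, ← hb, smul_eq_mul, smul_eq_mul, mul_comm, mul_comm (f y)]

/-- A Hermitian form that vanishes on `K₁`, on `K₂` and on `(K₁ ∩ K₂) × V`, where `K₁` and `K₂` are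
the left kernels of `B` and `F`, is of the form `B Z F* + F Z* B*`. -/
theorem exists_pert_eq_of_vanish (B : Matrix n p ℂ) (F : Matrix n q ℂ) {Δ : Matrix n n ℂ}
    (hΔ : Δ.IsHermitian)
    (h1 : ∀ x ∈ leftKer B, ∀ y ∈ leftKer B, hform Δ x y = 0)
    (h2 : ∀ x ∈ leftKer F, ∀ y ∈ leftKer F, hform Δ x y = 0)
    (h0 : ∀ x ∈ leftKer B ⊓ leftKer F, ∀ y, hform Δ x y = 0) :
    ∃ Z : Matrix p q ℂ, pert B F Z = Δ := by
  classical
  obtain ⟨π₁, hπ₁, hπ₁', hπ₁F⟩ := exists_projection_map_le (leftKer B) (leftKer F)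
  obtain ⟨π₂, hπ₂, hπ₂', hπ₂B⟩ := exists_projection_map_le (leftKer F) (leftKer B)
  set P : Matrix n n ℂ := 1 - LinearMap.toMatrix' π₁ with hP
  set Q : Matrix n n ℂ := 1 - LinearMap.toMatrix' π₂ with hQ
  have hPx : ∀ x, P *ᵥ x = x - π₁ x := fun x => by
    rw [hP, Matrix.sub_mulVec, Matrix.one_mulVec, LinearMap.toMatrix'_mulVec]
  have hQx : ∀ x, Q *ᵥ x = x - π₂ x := fun x => by
    rw [hQ, Matrix.sub_mulVec, Matrix.one_mulVec, LinearMap.toMatrix'_mulVec]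
  have hform2 : ∀ (R S : Matrix n n ℂ) (x y : n → ℂ),
      hform (Rᴴ * Δ * S) x y = hform Δ (R *ᵥ x) (S *ᵥ y) := fun R S x y => by
    simp only [hform, Matrix.star_mulVec, ← Matrix.mulVec_mulVec, Matrix.dotProduct_mulVec,
      Matrix.vecMul_vecMul]
  -- P kills K₁ and Q kills K₂, so P*ΔQ has the form BZF*. The remainder D has both K₁ and K₂ in its
  -- kernel, because the projections preserve the other subspace and Δ vanishes on K₁, on K₂ and
  -- against K₀. Thus D/2 may be added to P*ΔQ, and Ψ + Ψ* becomes Δ.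
  set D := Δ - Pᴴ * Δ * Q - Qᴴ * Δ * P with hD
  have hDh : D.IsHermitian := by
    simp only [Matrix.IsHermitian, hD, Matrix.conjTranspose_sub, Matrix.conjTranspose_mul,
      Matrix.conjTranspose_conjTranspose, hΔ.eq, Matrix.mul_assoc]
    abel
  have hDform : ∀ x y, hform D x y =
      hform Δ x y - hform Δ (P *ᵥ x) (Q *ᵥ y) - hform Δ (Q *ᵥ x) (P *ᵥ y) := fun x y => by
    rw [← hform2, ← hform2, hD]
    simp only [hform, Matrix.sub_mulVec, dotProduct_sub]
  have hD1 : ∀ x ∈ leftKer B, ∀ y, hform D x y = 0 := by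
    intro x hx y
    have e1 : P *ᵥ x = 0 := by rw [hPx, hπ₁' x hx, sub_self]
    have e2 : hform Δ x y = hform Δ (x - π₂ x) y := by
      rw [hform_sub_left, h0 (π₂ x) ⟨hπ₂B x hx, hπ₂ x⟩, sub_zero]
    have e3 : hform Δ (x - π₂ x) (y - π₁ y) = hform Δ (x - π₂ x) y := by
      rw [hform_sub_right, h1 _ (sub_mem hx (hπ₂B x hx)) _ (hπ₁ y), sub_zero]
    rw [hDform, e1, hQx x, hPx y, e3, e2, hform_zero_left]
    ring
  have hD2 : ∀ x ∈ leftKer F, ∀ y, hform D x y = 0 := by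
    intro x hx y
    have e1 : Q *ᵥ x = 0 := by rw [hQx, hπ₂' x hx, sub_self]
    have e2 : hform Δ x y = hform Δ (x - π₁ x) y := by
      rw [hform_sub_left, h0 (π₁ x) ⟨hπ₁ x, hπ₁F x hx⟩, sub_zero]
    have e3 : hform Δ (x - π₁ x) (y - π₂ y) = hform Δ (x - π₁ x) y := by
      rw [hform_sub_right, h2 _ (sub_mem hx (hπ₁F x hx)) _ (hπ₂ y), sub_zero]
    rw [hDform, e1, hPx x, hQx y, e3, e2, hform_zero_left]
    ring
  have hkill : ∀ x, (∀ y, hform D x y = 0) → D *ᵥ x = 0 := fun x hx =>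
    hform_eq_zero_of_forall_left fun y => hDh.hform_eq_zero_comm.1 (hx y)
  obtain ⟨Z, hZ⟩ := exists_pert_eq B F (Pᴴ * Δ * Q + (1 / 2 : ℂ) • D)
    (fun x hx => by
      have e1 : P *ᵥ x = 0 := by rw [hPx, hπ₁' x hx, sub_self]
      simp only [Matrix.conjTranspose_add, Matrix.conjTranspose_mul, Matrix.conjTranspose_smul,
        Matrix.conjTranspose_conjTranspose, hDh.eq, Matrix.add_mulVec, Matrix.smul_mulVec,
        hkill x (hD1 x hx), ← Matrix.mulVec_mulVec, e1]
      simp)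
    (fun x hx => by
      have e1 : Q *ᵥ x = 0 := by rw [hQx, hπ₂' x hx, sub_self]
      simp only [Matrix.add_mulVec, Matrix.smul_mulVec,
        hkill x (hD2 x hx), ← Matrix.mulVec_mulVec, e1]
      simp)
  refine ⟨Z, hZ.trans ?_⟩
  have hs : star (1 / 2 : ℂ) = 1 / 2 := by simp
  simp only [Matrix.conjTranspose_add, Matrix.conjTranspose_mul, Matrix.conjTranspose_smul,
        Matrix.conjTranspose_conjTranspose, hDh.eq, hΔ.eq, hs]
  have : (1 / 2 : ℂ) • D + (1 / 2 : ℂ) • D = D := by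
    rw [← add_smul]; norm_num
  calc _ = Pᴴ * Δ * Q + Qᴴ * (Δ * P) + ((1 / 2 : ℂ) • D + (1 / 2 : ℂ) • D) := by abel
    _ = Δ := by rw [this, hD, Matrix.mul_assoc Qᴴ]; abel

omit [Fintype p] in
theorem mulVec_mem_leftKer {k : Type*} [Fintype k] (T : Matrix n k ℂ) (C : Matrix n p ℂ)
    {v : k → ℂ} (hv : v ∈ leftKer (Tᴴ * C)) : T *ᵥ v ∈ leftKer C := by
  rw [mem_leftKer] at hv ⊢
  rw [Matrix.mulVec_mulVec, ← hv, Matrix.conjTranspose_mul, Matrix.conjTranspose_conjTranspose]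

/-- A parametrisation T of J turns B, F into T*B, T*F, whose left kernels are the preimages of those
of B and F. The case of the whole space then applies with the same Z. -/
theorem exists_pert_hform_eq_on (B : Matrix n p ℂ) (F : Matrix n q ℂ) {Δ : Matrix n n ℂ}
    (hΔ : Δ.IsHermitian) (J : Submodule ℂ (n → ℂ))
    (h1 : ∀ x ∈ J ⊓ leftKer B, ∀ y ∈ J ⊓ leftKer B, hform Δ x y = 0)
    (h2 : ∀ x ∈ J ⊓ leftKer F, ∀ y ∈ J ⊓ leftKer F, hform Δ x y = 0)
    (h0 : ∀ x ∈ J ⊓ leftKer B ⊓ leftKer F, ∀ y ∈ J, hform Δ x y = 0) :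
    ∃ Z : Matrix p q ℂ, ∀ x ∈ J, ∀ y ∈ J, hform (pert B F Z) x y = hform Δ x y := by
  classical
  let T : Matrix n (Fin (finrank ℂ J)) ℂ :=
    LinearMap.toMatrix' (J.subtype ∘ₗ ((finBasis ℂ J).equivFun.symm : _ →ₗ[ℂ] J))
  have hTx : ∀ v, T *ᵥ v = ((finBasis ℂ J).equivFun.symm v : n → ℂ) := fun v => by
    simp only [T, LinearMap.toMatrix'_mulVec]
    rfl
  have hTJ : ∀ v, T *ᵥ v ∈ J := fun v => by rw [hTx]; exact Subtype.property _
  have hTs : ∀ x ∈ J, ∃ v, T *ᵥ v = x := fun x hx =>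
    ⟨(finBasis ℂ J).equivFun ⟨x, hx⟩, by rw [hTx, LinearEquiv.symm_apply_apply]⟩
  obtain ⟨Z, hZ⟩ := exists_pert_eq_of_vanish (Tᴴ * B) (Tᴴ * F)
    (Matrix.isHermitian_conjTranspose_mul_mul T hΔ)
    (fun x hx y hy => by
      rw [hform_conj_mul]
      exact h1 _ ⟨hTJ x, mulVec_mem_leftKer T B hx⟩ _ ⟨hTJ y, mulVec_mem_leftKer T B hy⟩)
    (fun x hx y hy => by
      rw [hform_conj_mul]
      exact h2 _ ⟨hTJ x, mulVec_mem_leftKer T F hx⟩ _ ⟨hTJ y, mulVec_mem_leftKer T F hy⟩)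
    (fun x hx y => by
      rw [hform_conj_mul]
      exact h0 _ ⟨⟨hTJ x, mulVec_mem_leftKer T B hx.1⟩, mulVec_mem_leftKer T F hx.2⟩ _ (hTJ y))
  refine ⟨Z, fun x hx y hy => ?_⟩
  obtain ⟨v, rfl⟩ := hTs x hx
  obtain ⟨w, rfl⟩ := hTs y hy
  rw [← hform_conj_mul, ← hform_conj_mul, ← hZ]
  congr 1
  simp only [pert, Matrix.conjTranspose_mul, Matrix.conjTranspose_conjTranspose, Matrix.mul_add,
    Matrix.add_mul, Matrix.mul_assoc]

theorem exists_hform_left_eq (G : Matrix n n ℂ) (f : (n → ℂ) →ₗ[ℂ] ℂ)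
    (hf : perp G ⊤ ≤ LinearMap.ker f) : ∃ v, ∀ y, f y = hform G v y := by
  classical
  obtain ⟨X, hX⟩ := exists_mul_mul_self_eq G
  obtain ⟨a, ha⟩ := exists_dotProduct_eq (f ∘ₗ X.mulVecLin)
  refine ⟨star a, fun y => ?_⟩
  have h1 : y - X *ᵥ G *ᵥ y ∈ LinearMap.ker f := by
    apply hf
    rw [perp_top, LinearMap.mem_ker, Matrix.mulVecLin_apply, Matrix.mulVec_sub,
      Matrix.mulVec_mulVec, Matrix.mulVec_mulVec, hX, sub_self]
  rw [LinearMap.mem_ker, map_sub, sub_eq_zero] at h1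
  rw [h1, hform, star_star, ← ha]
  rfl

end Perturbation

/-! ### Maximal rank and maximal positive index -/

section Maximal

open Module

variable {n p q : Type*} [Fintype n] [Fintype p] [Fintype q]

theorem exists_notMem_notMem {V : Type*} [AddCommGroup V] [Module ℂ V]
    {N K L : Submodule ℂ V} (hK : ¬N ≤ K) (hL : ¬N ≤ L) : ∃ x ∈ N, x ∉ K ∧ x ∉ L := by
  obtain ⟨x, hxN, hxK⟩ := SetLike.not_le_iff_exists.1 hK
  obtain ⟨y, hyN, hyL⟩ := SetLike.not_le_iff_exists.1 hL
  by_cases hx : x ∈ L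
  · by_cases hy : y ∈ K
    · exact ⟨x + y, N.add_mem hxN hyN, fun h => hxK ((K.add_mem_iff_left hy).1 h),
        fun h => hyL ((L.add_mem_iff_right hx).1 h)⟩
    · exact ⟨y, hyN, hy, hyL⟩
  · exact ⟨x, hxN, hxK, hx⟩

theorem exists_functional_eq_one {V : Type*} [AddCommGroup V] [Module ℂ V]
    {K : Submodule ℂ V} {x : V} (hx : x ∉ K) :
    ∃ f : V →ₗ[ℂ] ℂ, f x = 1 ∧ K ≤ LinearMap.ker f := by
  obtain ⟨f, hfx, hf⟩ := Submodule.exists_le_ker_of_notMem hx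
  refine ⟨(f x)⁻¹ • f, by simp [hfx], fun y hy => ?_⟩
  have := LinearMap.mem_ker.1 (hf hy)
  simp [this]

theorem rank_lt_rank_of_ker {A A' : Matrix n n ℂ} (f : (n → ℂ) →ₗ[ℂ] ℂ)
    (h : ∀ y, A' *ᵥ y = 0 → A *ᵥ y = 0 ∧ f y = 0) {x : n → ℂ} (hx : A *ᵥ x = 0) (hfx : f x ≠ 0) :
    A.rank < A'.rank := by
  have h1 := finrank_ker_mulVecLin_add_rank A
  have h2 := finrank_ker_mulVecLin_add_rank A'
  have h3 : LinearMap.ker A'.mulVecLin < LinearMap.ker A.mulVecLin :=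
    lt_of_le_not_ge (fun y hy => (h y hy).1) fun hle => hfx (h x (hle hx)).2
  have h4 := Submodule.finrank_lt_finrank_of_lt h3
  omega

theorem hform_mulVec_eq_zero {A : Matrix n n ℂ} {y : n → ℂ} (h : A *ᵥ y = 0) (x : n → ℂ) :
    hform A x y = 0 := by
  rw [hform, h, dotProduct_zero]

/-- With f(x) = g(x) = 1, pairing a vector y of the perturbed kernel with x gives g(y) = −f(y). The
aim is f(y) = 0: then y ∈ ker G ∩ ker f, which is smaller than ker G because it misses x. -/
theorem exists_rank_lt_of_notMem {B : Matrix n p ℂ} {F : Matrix n q ℂ} {G : Matrix n n ℂ}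
    (hG : G.IsHermitian) {x : n → ℂ} (hx : G *ᵥ x = 0) (hxB : x ∉ leftKer B)
    (hxF : x ∉ leftKer F) : ∃ Z : Matrix p q ℂ, G.rank < (G + pert B F Z).rank := by
  obtain ⟨f, hfx, hf⟩ := exists_functional_eq_one hxB
  obtain ⟨g, hgx, hg⟩ := exists_functional_eq_one hxF
  have hl : ∀ z, G *ᵥ z = 0 → ∀ y, hform G z y = 0 := fun z hz y =>
    hG.hform_eq_zero_comm.1 (hform_mulVec_eq_zero hz y)
  by_cases hN : ∃ z, G *ᵥ z = 0 ∧ f z ≠ g z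
  · obtain ⟨z, hz, hfg⟩ := hN
    obtain ⟨Z, hZ⟩ := exists_pert_hform_functionals B F f g hf hg
    refine ⟨Z, rank_lt_rank_of_ker f (fun y hy => ?_) hx (by simp [hfx])⟩
    have E : ∀ v, hform G v y + (star (f v) * g y + star (g v) * f y) = 0 := fun v => by
      rw [← hZ, ← hform_matrix_add, hform_mulVec_eq_zero hy]
    have e1 := E x
    rw [hl x hx, hfx, hgx] at e1
    simp only [star_one, one_mul, zero_add] at e1
    have e2 := E z
    rw [hl z hz, zero_add] at e2
    have hg0 : g y = -f y := eq_neg_of_add_eq_zero_left e1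
    have e3 : (star (g z) - star (f z)) * f y = 0 := by rw [hg0] at e2; linear_combination e2
    have hfy : f y = 0 := by
      rcases mul_eq_zero.1 e3 with h | h
      · exact absurd (star_injective (sub_eq_zero.1 h)).symm hfg
      · exact h
    refine ⟨hform_eq_zero_of_forall_left fun v => ?_, hfy⟩
    have := E v
    rwa [hg0, hfy, neg_zero, mul_zero, mul_zero, add_zero, add_zero] at this
  · push Not at hN
    -- Now f = g on ker G, so f − g is represented by some v₀. With f scaled by t, the vector y − t
    -- f(y) v₀ lies in ker G. Equality of f and g there reads f(y)(2 − t(f − g)(v₀)) = 0, and t ≠ 0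
    -- is chosen so that the second factor does not vanish.
    obtain ⟨v₀, hv₀⟩ := exists_hform_left_eq G (f - g) (fun z hz => by
      rw [perp_top] at hz
      rw [LinearMap.mem_ker, LinearMap.sub_apply, hN z hz, sub_self])
    obtain ⟨t, ht0, htc⟩ : ∃ t : ℝ, t ≠ 0 ∧ (t : ℂ) * (f v₀ - g v₀) ≠ 2 := by
      by_cases h1 : f v₀ - g v₀ = 2
      · exact ⟨2, two_ne_zero, by rw [h1]; norm_num⟩
      · exact ⟨1, one_ne_zero, by simpa using h1⟩
    obtain ⟨Z, hZ⟩ := exists_pert_hform_functionals B F ((t : ℂ) • f) g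
      (fun y hy => by simp [LinearMap.mem_ker.1 (hf hy)]) hg
    refine ⟨Z, rank_lt_rank_of_ker f (fun y hy => ?_) hx (by simp [hfx])⟩
    have E : ∀ v, hform G v y + t * (star (f v) * g y + star (g v) * f y) = 0 := fun v => by
      rw [← hform_mulVec_eq_zero hy v, hform_matrix_add, hZ]
      simp
      ring
    have e1 := E x
    rw [hl x hx, hfx, hgx] at e1
    simp only [star_one, one_mul, zero_add, mul_eq_zero, Complex.ofReal_eq_zero, ht0,
      false_or] at e1
    have hg0 : g y = -f y := eq_neg_of_add_eq_zero_left e1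
    have e2 : G *ᵥ (y - ((t : ℂ) * f y) • v₀) = 0 := hform_eq_zero_of_forall_left fun v => by
      have h1 := E v
      have h2 : hform G v v₀ = star (f v) - star (g v) := by
        rw [← hG.star_hform, ← hv₀, LinearMap.sub_apply, star_sub]
      rw [hform_sub_right, hform_smul_right, h2]
      rw [hg0] at h1
      linear_combination h1
    have e3 := hN _ e2
    simp only [map_sub, map_smul, smul_eq_mul, hg0] at e3
    have e4 : f y * (2 - t * (f v₀ - g v₀)) = 0 := by linear_combination e3
    have hfy : f y = 0 := by
      rcases mul_eq_zero.1 e4 with h | h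
      · exact h
      · exact absurd (sub_eq_zero.1 h).symm htc
    refine ⟨?_, hfy⟩
    rwa [hfy, mul_zero, zero_smul, sub_zero] at e2

/-- Maximality forces K^⊥ ⊆ K for K = ker B*; the inequality is then the dimension formula for K^⊥.
-/
theorem card_le_of_rank_maximal {B : Matrix n p ℂ} {F : Matrix n q ℂ} {G : Matrix n n ℂ}
    (hG : G.IsHermitian) (hmax : ∀ Z : Matrix p q ℂ, (G + pert B F Z).rank ≤ G.rank)
    (hN : perp G ⊤ ≤ leftKer B) (hF : ¬perp G ⊤ ≤ leftKer F) :
    2 * Fintype.card n ≤ G.rank + finrank ℂ (leftKer B) +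
      finrank ℂ (leftKer B ⊓ perp G (leftKer B) : Submodule ℂ (n → ℂ)) := by
  obtain ⟨x, hxN, hxF⟩ := SetLike.not_le_iff_exists.1 hF
  obtain ⟨g, hgx, hg⟩ := exists_functional_eq_one hxF
  -- For v ∈ K^⊥ the functional f = G(v, ·) kills K and is admissible. If G(v, v) ≠ 0, a vector y of
  -- the perturbed kernel satisfies G(v, y) = 0 by pairing with x; then y + g(y)v ∈ ker G, and
  -- pairing with v gives g(y) = 0. The kernel would shrink.
  have hiso : ∀ v ∈ perp G (leftKer B), hform G v v = 0 := by
    intro v hv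
    by_contra hne
    obtain ⟨Z, hZ⟩ := exists_pert_hform_functionals B F (hformRight G v) g
      (fun y hy => hG.hform_eq_zero_comm.1 (hv y hy)) hg
    have hx : G *ᵥ x = 0 := by rwa [perp_top] at hxN
    refine absurd (hmax Z) (not_le.2 (rank_lt_rank_of_ker g (fun y hy => ?_) hx (by simp [hgx])))
    have E : ∀ w, hform G w y + (star (hform G v w) * g y + star (g w) * hform G v y) = 0 :=
      fun w => by
        rw [← hform_mulVec_eq_zero hy w, hform_matrix_add, hZ]
        rfl
    have e1 := E x
    rw [hG.hform_eq_zero_comm.1 (hform_mulVec_eq_zero hx y), hform_mulVec_eq_zero hx v, hgx] at e1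
    simp only [star_zero, star_one, one_mul, zero_mul, zero_add] at e1
    have e2 : G *ᵥ (y + g y • v) = 0 := hform_eq_zero_of_forall_left fun w => by
      have := E w
      rw [e1, hG.star_hform] at this
      rw [hform_add_right, hform_smul_right]
      linear_combination this
    have e3 : hform G v (y + g y • v) = 0 := hform_mulVec_eq_zero e2 v
    rw [hform_add_right, hform_smul_right, e1, zero_add, mul_eq_zero, or_iff_left hne] at e3
    rw [e3, zero_smul, add_zero] at e2
    exact ⟨e2, e3⟩
  -- A functional that kills K ⊇ ker G and is 1 at v ∉ K would be G(v₀, ·) with v₀ ∈ K^⊥,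
  -- contradicting that K^⊥ is totally isotropic.
  have hle : perp G (leftKer B) ≤ leftKer B := by
    intro v hv
    by_contra hvB
    obtain ⟨f, hfv, hf⟩ := exists_functional_eq_one hvB
    obtain ⟨v₀, hv₀⟩ := exists_hform_left_eq G f (hN.trans hf)
    have hv₀' : v₀ ∈ perp G (leftKer B) := fun y hy =>
      hG.hform_eq_zero_comm.1 (by rw [← hv₀]; exact hf hy)
    have hnon : NonposOn G (perp G (leftKer B)) := fun y hy => by rw [hiso y hy]; rfl
    rw [hv₀, hnon.hform_eq_zero hG hv₀' hv (by rw [hiso _ hv₀']; rfl)] at hfv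
    exact zero_ne_one hfv
  have h1 := finrank_add_finrank_inf_ker_le G hG (leftKer B)
  have h2 := finrank_ker_mulVecLin_add_rank G
  rw [inf_eq_right.2 hN, perp_top] at h1
  rw [inf_eq_right.2 hle]
  omega

theorem inf_perp_pert_left {B : Matrix n p ℂ} {F : Matrix n q ℂ} (H : Matrix n n ℂ)
    (Z : Matrix p q ℂ) :
    leftKer B ⊓ perp (H + pert B F Z) (leftKer B) = leftKer B ⊓ perp H (leftKer B) := by
  ext y
  refine and_congr_right fun hy => forall₂_congr fun x hx => ?_
  rw [hform_matrix_add, hform_pert_of_mem_left Z hx hy, add_zero]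

theorem inf_perp_pert_right {B : Matrix n p ℂ} {F : Matrix n q ℂ} (H : Matrix n n ℂ)
    (Z : Matrix p q ℂ) :
    leftKer F ⊓ perp (H + pert B F Z) (leftKer F) = leftKer F ⊓ perp H (leftKer F) := by
  ext y
  refine and_congr_right fun hy => forall₂_congr fun x hx => ?_
  rw [hform_matrix_add, hform_pert_of_mem_right Z hx hy, add_zero]

theorem hform_add_pert_of_mem_inf {B : Matrix n p ℂ} {F : Matrix n q ℂ} (H : Matrix n n ℂ)
    (Z : Matrix p q ℂ) {x : n → ℂ} (hx : x ∈ leftKer B ⊓ leftKer F)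
    (y : n → ℂ) : hform (H + pert B F Z) y x = hform H y x := by
  rw [hform_matrix_add, (pert_isHermitian B F Z).hform_eq_zero_comm.1
    (hform_pert_of_mem_inf Z hx), add_zero]

theorem inf_perp_top_pert {B : Matrix n p ℂ} {F : Matrix n q ℂ} (H : Matrix n n ℂ)
    (Z : Matrix p q ℂ) :
    leftKer B ⊓ leftKer F ⊓ perp (H + pert B F Z) ⊤ = leftKer B ⊓ leftKer F ⊓ perp H ⊤ := by
  ext y
  refine and_congr_right fun hy => forall₂_congr fun x hx => ?_
  rw [hform_add_pert_of_mem_inf H Z hy]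

theorem exists_rank_add_pert_ge (B : Matrix n p ℂ) (F : Matrix n q ℂ) {H : Matrix n n ℂ}
    (hH : H.IsHermitian) : ∃ Z : Matrix p q ℂ,
      Fintype.card n ≤ (H + pert B F Z).rank +
        finrank ℂ (leftKer B ⊓ leftKer F ⊓ perp H ⊤ : Submodule ℂ (n → ℂ)) ∨
      2 * Fintype.card n ≤ (H + pert B F Z).rank + finrank ℂ (leftKer B) +
        finrank ℂ (leftKer B ⊓ perp H (leftKer B) : Submodule ℂ (n → ℂ)) ∨
      2 * Fintype.card n ≤ (H + pert B F Z).rank + finrank ℂ (leftKer F) +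
        finrank ℂ (leftKer F ⊓ perp H (leftKer F) : Submodule ℂ (n → ℂ)) := by
  have hbd : BddAbove (Set.range fun Z : Matrix p q ℂ => (H + pert B F Z).rank) := by
    refine ⟨Fintype.card n, ?_⟩
    rintro _ ⟨Z, rfl⟩
    exact Matrix.rank_le_card_width _
  obtain ⟨Z, hZ⟩ := Nat.sSup_mem (Set.range_nonempty _) hbd
  have hG : (H + pert B F Z).IsHermitian := hH.add (pert_isHermitian B F Z)
  have hmax : ∀ Z', (H + pert B F Z + pert B F Z').rank ≤ (H + pert B F Z).rank := by
    intro Z'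
    rw [add_assoc, ← pert_add]
    exact (le_csSup hbd ⟨Z + Z', rfl⟩).trans_eq hZ.symm
  refine ⟨Z, ?_⟩
  rw [← inf_perp_pert_left (F := F) H Z, ← inf_perp_pert_right (B := B) H Z,
    ← inf_perp_top_pert H Z]
  by_cases hNB : perp (H + pert B F Z) ⊤ ≤ leftKer B
  · by_cases hNF : perp (H + pert B F Z) ⊤ ≤ leftKer F
    · left
      have h2 := finrank_ker_mulVecLin_add_rank (H + pert B F Z)
      rw [inf_eq_right.2 (le_inf hNB hNF), perp_top]
      omega
    · exact Or.inr (Or.inl (card_le_of_rank_maximal hG hmax hNB hNF))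
  · by_cases hNF : perp (H + pert B F Z) ⊤ ≤ leftKer F
    · refine Or.inr (Or.inr (card_le_of_rank_maximal hG (fun Z' => ?_) hNF hNB))
      have := hmax Z'ᴴ
      rwa [← pert_swap B F Z'ᴴ, Matrix.conjTranspose_conjTranspose] at this
    · obtain ⟨x, hxN, hxB, hxF⟩ := exists_notMem_notMem hNB hNF
      rw [perp_top] at hxN
      obtain ⟨Z', hZ'⟩ := exists_rank_lt_of_notMem hG hxN hxB hxF
      exact absurd (hmax Z') (not_le.2 hZ')

/-- Some x' ∈ P^⊥ lies outside ker B* + P and ker F* + P. Functionals that also vanish on P leave G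
unchanged on P × V, so x' stays orthogonal to P while its value can be prescribed. -/
theorem PosOn.exists_extension {B : Matrix n p ℂ} {F : Matrix n q ℂ} {G : Matrix n n ℂ}
    (hG : G.IsHermitian) {P : Submodule ℂ (n → ℂ)} (hP : PosOn G P)
    (hB : leftKer B ⊔ P ≠ ⊤) (hF : leftKer F ⊔ P ≠ ⊤) :
    ∃ Z : Matrix p q ℂ, ∃ P', P < P' ∧ PosOn (G + pert B F Z) P' := by
  obtain ⟨x, -, hxB, hxF⟩ := exists_notMem_notMem (N := ⊤) (fun h => hB (top_le_iff.1 h))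
    (fun h => hF (top_le_iff.1 h))
  have hx : x ∈ P ⊔ ⊤ ⊓ perp G P := by rw [hP.sup_perp le_top]; trivial
  obtain ⟨u, hu, x', hx', rfl⟩ := Submodule.mem_sup.1 hx
  rw [Submodule.add_mem_iff_right _ (Submodule.mem_sup_right hu)] at hxB hxF
  obtain ⟨f, hfx, hf⟩ := exists_functional_eq_one hxB
  obtain ⟨g, hgx, hg⟩ := exists_functional_eq_one hxF
  rw [sup_le_iff] at hf hg
  -- The perturbation adds 2t at x', so the new value there is 1.
  set t : ℝ := (1 - (hform G x' x').re) / 2 with ht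
  obtain ⟨Z, hZ⟩ := exists_pert_hform_functionals B F ((t : ℂ) • f) g
    (fun y hy => by simp [LinearMap.mem_ker.1 (hf.1 hy)]) hg.1
  have hPz : ∀ v ∈ P, ∀ w, hform (G + pert B F Z) v w = hform G v w := fun v hv w => by
    rw [hform_matrix_add, hZ, LinearMap.smul_apply, LinearMap.mem_ker.1 (hf.2 hv),
      LinearMap.mem_ker.1 (hg.2 hv)]
    simp
  have hxpos : 0 < (hform (G + pert B F Z) x' x').re := by
    rw [hform_matrix_add, hZ, LinearMap.smul_apply, hfx, hgx]
    simp only [smul_eq_mul, mul_one, star_one, one_mul, Complex.star_def, Complex.conj_ofReal,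
      Complex.add_re, Complex.ofReal_re, ht]
    linarith
  refine ⟨Z, P ⊔ ℂ ∙ x', lt_of_le_of_ne le_sup_left fun heq => ?_,
    PosOn.sup (hG.add (pert_isHermitian B F Z)) (fun v hv h0 => ?_)
      (posOn_span_singleton hxpos) ?_⟩
  · refine hxB (Submodule.mem_sup_right ?_)
    rw [heq]
    exact Submodule.mem_sup_right (Submodule.mem_span_singleton_self x')
  · rw [hPz v hv]
    exact hP v hv h0
  · intro v hv w hw
    obtain ⟨c, rfl⟩ := Submodule.mem_span_singleton.1 hw
    rw [hform_smul_right, hPz v hv, hx'.2 v hv, mul_zero]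

theorem exists_projection_of_inf_eq_bot {V : Type*} [AddCommGroup V] [Module ℂ V]
    [FiniteDimensional ℂ V] {P K : Submodule ℂ V} (h : ∀ x ∈ P, x ∈ K → x = 0) :
    ∃ α : V →ₗ[ℂ] V, (∀ x ∈ P, α x = x) ∧ ∀ x ∈ K, α x = 0 := by
  obtain ⟨π, hπ, hπ', hπP⟩ := exists_projection_map_le K P
  refine ⟨LinearMap.id - π, fun x hx => ?_, fun x hx => ?_⟩
  · rw [LinearMap.sub_apply, LinearMap.id_apply, h _ (hπP x hx) (hπ x), sub_zero]
  · rw [LinearMap.sub_apply, LinearMap.id_apply, hπ' x hx, sub_self]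

/-- Take α = id on Q and 0 on ker B*, β = id on P and 0 on ker F*. Subtracting H(α·, β·) and its
adjoint cancels H on P × Q; the first term is idle there because α kills P ⊆ ker B*. -/
theorem exists_pert_hform_eq_neg {B : Matrix n p ℂ} {F : Matrix n q ℂ} {H : Matrix n n ℂ}
    {P Q : Submodule ℂ (n → ℂ)} (hP : P ≤ leftKer B) (hPF : ∀ x ∈ P, x ∈ leftKer F → x = 0)
    (hQB : ∀ x ∈ Q, x ∈ leftKer B → x = 0) (hH : H.IsHermitian) :
    ∃ Z : Matrix p q ℂ, ∀ x ∈ P, ∀ y ∈ Q, hform (H + pert B F Z) x y = 0 := by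
  classical
  obtain ⟨α, hα, hα'⟩ := exists_projection_of_inf_eq_bot hQB
  obtain ⟨β, hβ, hβ'⟩ := exists_projection_of_inf_eq_bot hPF
  set R := LinearMap.toMatrix' α
  set S := LinearMap.toMatrix' β
  have hR : ∀ x, R *ᵥ x = α x := fun x => LinearMap.toMatrix'_mulVec _ _
  have hS : ∀ x, S *ᵥ x = β x := fun x => LinearMap.toMatrix'_mulVec _ _
  have hform2 : ∀ x y, hform (Rᴴ * H * S) x y = hform H (α x) (β y) := fun x y => by
    rw [← hR, ← hS]
    simp only [hform, Matrix.star_mulVec, ← Matrix.mulVec_mulVec, Matrix.dotProduct_mulVec,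
      Matrix.vecMul_vecMul]
  have hΨ : ∀ x ∈ leftKer B, (-(Rᴴ * H * S))ᴴ *ᵥ x = 0 := fun x hx => by
    simp only [Matrix.conjTranspose_neg, Matrix.conjTranspose_mul,
      Matrix.conjTranspose_conjTranspose, Matrix.neg_mulVec, ← Matrix.mulVec_mulVec, hR, hα' x hx,
      Matrix.mulVec_zero, neg_zero]
  obtain ⟨Z, hZ⟩ := exists_pert_eq B F (-(Rᴴ * H * S)) hΨ (fun x hx => by
    simp only [Matrix.neg_mulVec, ← Matrix.mulVec_mulVec, hS, hβ' x hx,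
      Matrix.mulVec_zero, neg_zero])
  refine ⟨Z, fun x hx y hy => ?_⟩
  rw [hform_matrix_add, hZ, hform_matrix_add, hform_conjTranspose, hform_neg, hform_neg, hform2,
    hform2, hα' x (hP hx), hα y hy, hβ x hx, hform_zero_left, star_neg, hH.star_hform]
  ring

theorem exists_posDim_add_pert_ge (B : Matrix n p ℂ) (F : Matrix n q ℂ) {H : Matrix n n ℂ}
    (hH : H.IsHermitian) : ∃ Z : Matrix p q ℂ,
      posDim H (leftKer B) + Fintype.card n ≤
        posDim (H + pert B F Z) ⊤ + finrank ℂ (leftKer B) ∨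
      posDim H (leftKer F) + Fintype.card n ≤
        posDim (H + pert B F Z) ⊤ + finrank ℂ (leftKer F) := by
  obtain ⟨P₀, -, hP₀, hpos₀, hnon, -⟩ := PosOn.exists_maximal hH (P := ⊥)
    (K := leftKer B ⊓ leftKer F) (fun x hx h0 => absurd (by simpa using hx) h0) bot_le
  obtain ⟨P₁, h01, hP₁, hpos₁, -, hd₁⟩ := hpos₀.exists_maximal hH (hP₀.trans inf_le_left)
  obtain ⟨P₂, h02, hP₂, hpos₂, -, hd₂⟩ := hpos₀.exists_maximal hH (hP₀.trans inf_le_right)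
  -- The parts of P₁ and P₂ orthogonal to P₀ meet K₀ trivially, since H is nonpositive on K₀ ∩ P₀^⊥.
  -- They can therefore be made mutually orthogonal, and P₁ + P₂ becomes definite.
  obtain ⟨Z₀, hZ₀⟩ := exists_pert_hform_eq_neg (B := B) (F := F) (H := H)
    (P := P₁ ⊓ perp H P₀) (Q := P₂ ⊓ perp H P₀)
    (inf_le_left.trans hP₁)
    (fun x hx hxF => by
      by_contra h0
      exact absurd (hpos₁ x hx.1 h0) (not_lt.2 (hnon x ⟨⟨hP₁ hx.1, hxF⟩, hx.2⟩)))
    (fun x hx hxB => by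
      by_contra h0
      exact absurd (hpos₂ x hx.1 h0) (not_lt.2 (hnon x ⟨⟨hxB, hP₂ hx.1⟩, hx.2⟩))) hH
  have hstart : PosOn (H + pert B F Z₀) (P₁ ⊔ P₂ ⊓ perp H P₀) := by
    refine PosOn.sup (hH.add (pert_isHermitian B F Z₀)) (fun x hx h0 => ?_) (fun x hx h0 => ?_) ?_
    · rw [hform_matrix_add, hform_pert_of_mem_left Z₀ (hP₁ hx) (hP₁ hx), add_zero]
      exact hpos₁ x hx h0
    · rw [hform_matrix_add, hform_pert_of_mem_right Z₀ (hP₂ hx.1) (hP₂ hx.1), add_zero]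
      exact hpos₂ x hx.1 h0
    · intro x hx y hy
      rw [← hpos₀.sup_perp h01] at hx
      obtain ⟨u, hu, v, hv, rfl⟩ := Submodule.mem_sup.1 hx
      rw [hform_add_left, hZ₀ v hv y hy, hform_matrix_add,
        hform_pert_of_mem_right Z₀ (hP₀ hu).2 (hP₂ hy.1), hy.2 u hu]
      simp
  have hP₂le : P₂ ≤ P₁ ⊔ P₂ ⊓ perp H P₀ := by
    conv_lhs => rw [← hpos₀.sup_perp h02]
    exact sup_le_sup_right h01 _
  -- Z and P vary together. A largest P satisfies Kᵢ + P = V for some i, by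
  -- `PosOn.exists_extension`. Since P ∩ Kᵢ still contains Pᵢ, counting dimensions gives the bound
  -- belonging to Kᵢ.
  set 𝒮 : Set ℕ := {d | ∃ Z : Matrix p q ℂ, ∃ P, P₁ ≤ P ∧ P₂ ≤ P ∧ PosOn (H + pert B F Z) P ∧
    finrank ℂ P = d} with h𝒮
  have hbd : BddAbove 𝒮 := by
    refine ⟨finrank ℂ (n → ℂ), ?_⟩
    rintro d ⟨Z, P, -, -, -, rfl⟩
    exact Submodule.finrank_le P
  obtain ⟨Z, P, h1, h2, hpos, hd⟩ := Nat.sSup_mem (s := 𝒮)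
    ⟨_, Z₀, _, le_sup_left, hP₂le, hstart, rfl⟩ hbd
  refine ⟨Z, ?_⟩
  have hPle := finrank_le_posDim (le_top : P ≤ ⊤) hpos
  have hfull : ∀ {K P' : Submodule ℂ (n → ℂ)}, P' ≤ P → P' ≤ K → finrank ℂ P' = posDim H K →
      K ⊔ P = ⊤ → posDim H K + Fintype.card n ≤ posDim (H + pert B F Z) ⊤ + finrank ℂ K := by
    intro K P' hP'P hP'K hd' htop
    have e1 := Submodule.finrank_sup_add_finrank_inf_eq K P
    have e2 := Submodule.finrank_mono (le_inf hP'K hP'P)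
    rw [htop, finrank_top, finrank_fintype_fun_eq_card] at e1
    omega
  by_cases hB : leftKer B ⊔ P = ⊤
  · exact Or.inl (hfull h1 hP₁ hd₁ hB)
  · by_cases hF : leftKer F ⊔ P = ⊤
    · exact Or.inr (hfull h2 hP₂ hd₂ hF)
    · exfalso
      obtain ⟨Z', P', hlt, hpos'⟩ := hpos.exists_extension (hH.add (pert_isHermitian B F Z)) hB hF
      rw [add_assoc, ← pert_add] at hpos'
      have h3 := Submodule.finrank_lt_finrank_of_lt hlt
      have h4 : finrank ℂ P' ≤ sSup 𝒮 :=
        le_csSup hbd ⟨Z + Z', P', h1.trans hlt.le, h2.trans hlt.le, hpos', rfl⟩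
      omega

end Maximal

/-! ### Minimal inertia -/

section Minimal

open Module

variable {n p q : Type*} [Fintype n] [Fintype p] [Fintype q]

theorem Matrix.IsHermitian.perp_comm {H : Matrix n n ℂ} (hH : H.IsHermitian)
    {K L : Submodule ℂ (n → ℂ)} (h : K ≤ perp H L) : L ≤ perp H K :=
  fun _ hx _ hy => hH.hform_eq_zero_comm.1 (h hy _ hx)

/-- Gram–Schmidt, padded by zero vectors up to length d so that frames of different subspaces can
share an index set. -/
theorem PosOn.exists_frame {H : Matrix n n ℂ} (hH : H.IsHermitian) (d : ℕ) :
    ∀ {P : Submodule ℂ (n → ℂ)}, PosOn H P → finrank ℂ P ≤ d →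
    ∃ e : Fin d → n → ℂ, (∀ i, e i ∈ P) ∧
      ∀ x ∈ P, ∀ y, hform H x y = ∑ i, star (hform H (e i) x) * hform H (e i) y := by
  induction d with
  | zero =>
    intro P _ hd
    refine ⟨Fin.elim0, fun i => i.elim0, fun x hx y => ?_⟩
    rw [Nat.le_zero, Submodule.finrank_eq_zero] at hd
    subst hd
    rw [(Submodule.mem_bot ℂ).1 hx]
    simp
  | succ d ih =>
    intro P hP hd
    by_cases hbot : P = ⊥
    · subst hbot
      refine ⟨fun _ => 0, fun _ => Submodule.zero_mem _, fun x hx y => ?_⟩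
      rw [(Submodule.mem_bot ℂ).1 hx]
      simp
    · obtain ⟨v, hv, hv0⟩ := Submodule.exists_mem_ne_zero_of_ne_bot hbot
      have hpos := hP v hv hv0
      set r : ℝ := (hform H v v).re with hr
      have hvv : hform H v v = (r : ℂ) := Complex.ext rfl (by simp [hH.hform_self_im v])
      set u : n → ℂ := ((Real.sqrt r)⁻¹ : ℂ) • v with hu
      have huP : u ∈ P := P.smul_mem _ hv
      have huu : hform H u u = 1 := by
        have hs : ((Real.sqrt r : ℝ) : ℂ) * (Real.sqrt r : ℝ) = r := by
          rw [← Complex.ofReal_mul, Real.mul_self_sqrt hpos.le]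
        have hs0 : ((Real.sqrt r : ℝ) : ℂ) ≠ 0 := by
          rw [Complex.ofReal_ne_zero]; exact (Real.sqrt_pos.2 hpos).ne'
        rw [hu, hform_smul_left, hform_smul_right, hvv, ← hs]
        simp only [star_inv₀, Complex.star_def, Complex.conj_ofReal]
        field_simp
      have hdecomp : ∀ x ∈ P, x - hform H u x • u ∈ P ⊓ perp H (ℂ ∙ u) := fun x hx =>
        ⟨P.sub_mem hx (P.smul_mem _ huP), fun w hw => by
          obtain ⟨c, rfl⟩ := Submodule.mem_span_singleton.1 hw
          rw [hform_smul_left, hform_sub_right, hform_smul_right, huu, mul_one, sub_self,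
            mul_zero]⟩
      have hlt : P ⊓ perp H (ℂ ∙ u) < P := by
        refine lt_of_le_of_ne inf_le_left fun heq => ?_
        rw [← heq] at huP
        have := huP.2 u (Submodule.mem_span_singleton_self u)
        rw [huu] at this
        exact one_ne_zero this
      have hlt' := Submodule.finrank_lt_finrank_of_lt hlt
      obtain ⟨e, heP, he⟩ := ih (P := P ⊓ perp H (ℂ ∙ u)) (fun x hx => hP x hx.1) (by omega)
      refine ⟨Fin.cons u e, fun i => ?_, fun x hx y => ?_⟩
      · refine Fin.cases ?_ (fun i => ?_) i
        · simpa using huP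
        · simpa using (heP i).1
      · have h1 : hform H x y = hform H (x - hform H u x • u) y +
            star (hform H u x) * hform H u y := by
          rw [hform_sub_left, hform_smul_left]; ring
        have h2 : ∀ i, hform H (e i) u = 0 := fun i =>
          hH.hform_eq_zero_comm.1 ((heP i).2 u (Submodule.mem_span_singleton_self u))
        rw [h1, he _ (hdecomp x hx), Fin.sum_univ_succ, add_comm]
        simp only [Fin.cons_zero, Fin.cons_succ, hform_sub_right, hform_smul_right, h2, mul_zero,
          sub_zero]

/-- On `K` the form is a signed sum of squares of functionals `x ↦ e* H x`, with `e ∈ K`. -/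
theorem exists_signed_frame {H : Matrix n n ℂ} (hH : H.IsHermitian) (K : Submodule ℂ (n → ℂ))
    {d d' : ℕ} (hd : posDim H K ≤ d) (hd' : posDim (-H) K ≤ d') :
    ∃ (e : Fin d → n → ℂ) (f : Fin d' → n → ℂ), (∀ i, e i ∈ K) ∧ (∀ i, f i ∈ K) ∧
      ∀ x ∈ K, ∀ y ∈ perp H (K ⊓ perp H K), hform H x y =
        ∑ i, star (hform H (e i) x) * hform H (e i) y -
          ∑ i, star (hform H (f i) x) * hform H (f i) y := by
  obtain ⟨P, N, hP, hN, hpos, hneg, hperp, hsup, -⟩ := exists_signature_decomposition hH K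
  obtain ⟨e, heP, he⟩ := hpos.exists_frame hH d ((finrank_le_posDim hP hpos).trans hd)
  obtain ⟨f, hfN, hf⟩ := hneg.exists_frame hH.neg d' ((finrank_le_posDim hN hneg).trans hd')
  refine ⟨e, f, fun i => hP (heP i), fun i => hN (hfN i), fun x hx y hy => ?_⟩
  rw [← hsup] at hx
  obtain ⟨u, hu, w, hw, rfl⟩ := Submodule.mem_sup.1 hx
  obtain ⟨r, hr, v, hv, rfl⟩ := Submodule.mem_sup.1 hw
  have h1 : ∀ i, hform H (e i) (u + (r + v)) = hform H (e i) u := fun i => by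
    rw [hform_add_right, hform_add_right, hr.2 _ (hP (heP i)), hperp hv _ (heP i)]
    simp
  have h2 : ∀ i, hform H (f i) (u + (r + v)) = hform H (f i) v := fun i => by
    rw [hform_add_right, hform_add_right, hr.2 _ (hN (hfN i)),
      hH.hform_eq_zero_comm.1 (hperp (hfN i) u hu)]
    simp
  have h3 := hf v hv y
  simp only [hform_neg, star_neg, neg_mul_neg] at h3
  rw [hform_add_left, hform_add_left, hy r hr, he u hu y]
  simp only [h1, h2]
  linear_combination -h3

theorem exists_isHermitian_hform_eq_sum {ι : Type*} [Fintype ι]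
    (φ : ι → (n → ℂ) →ₗ[ℂ] ℂ) :
    ∃ M : Matrix n n ℂ, M.IsHermitian ∧ ∀ x y, hform M x y = ∑ i, star (φ i x) * φ i y := by
  choose a ha using fun i => exists_dotProduct_eq (φ i)
  refine ⟨∑ i, Matrix.vecMulVec (star (a i)) (a i), ?_, fun x y => ?_⟩
  · rw [Matrix.IsHermitian, Matrix.conjTranspose_sum]
    exact Finset.sum_congr rfl fun i _ => by rw [Matrix.conjTranspose_vecMulVec, star_star]
  · rw [hform, Matrix.sum_mulVec, dotProduct_sum]
    refine Finset.sum_congr rfl fun i _ => ?_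
    rw [Matrix.vecMulVec_mulVec, ha, ha, dotProduct_smul, Matrix.star_dotProduct_star]
    simp [mul_comm]

/-- With π a projection onto K that preserves L, the functional fπ + g(1 − π) works: for x ∈ L the
vector πx lies in K ∩ L, where f = g. -/
theorem exists_functional_eq_eq {V : Type*} [AddCommGroup V] [Module ℂ V]
    [FiniteDimensional ℂ V] {K L : Submodule ℂ V} {f g : V →ₗ[ℂ] ℂ}
    (h : ∀ x ∈ K, x ∈ L → f x = g x) :
    ∃ φ : V →ₗ[ℂ] ℂ, (∀ x ∈ K, φ x = f x) ∧ ∀ x ∈ L, φ x = g x := by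
  obtain ⟨π, hπ, hπ', hπL⟩ := exists_projection_map_le K L
  refine ⟨f ∘ₗ π + g ∘ₗ (LinearMap.id - π), fun x hx => ?_, fun x hx => ?_⟩
  · simp [hπ' x hx]
  · simp [h (π x) (hπ x) (hπL x hx)]

theorem posDim_add_posDim_le {H : Matrix n n ℂ} (hH : H.IsHermitian)
    {K L M : Submodule ℂ (n → ℂ)} (hK : K ≤ M) (hL : L ≤ M) (h : L ≤ perp H K) :
    posDim H K + posDim H L ≤ posDim H M := by
  obtain ⟨P, hP, hpos, hd⟩ := exists_finrank_eq_posDim H K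
  obtain ⟨Q, hQ, hqos, hd'⟩ := exists_finrank_eq_posDim H L
  have horth : ∀ x ∈ P, ∀ y ∈ Q, hform H x y = 0 := fun x hx y hy => h (hQ hy) x (hP hx)
  have h1 := finrank_add_le_of_inf_eq_bot (le_sup_left : P ≤ P ⊔ Q) le_sup_right
    fun x hx hx' => hpos.eq_zero_of_perp hx fun y hy => horth y hy x hx'
  have h2 := finrank_le_posDim (sup_le (hP.trans hK) (hQ.trans hL)) (hpos.sup hH hqos horth)
  omega

/-- G is nonpositive on a subspace of codimension at most codim J + |ι|, which bounds its index. The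
pair r, c encodes codim J ≤ r − c without subtraction. -/
theorem posDim_top_add_le {ι : Type*} [Fintype ι] {G : Matrix n n ℂ}
    {J : Submodule ℂ (n → ℂ)} (φ : ι → (n → ℂ) →ₗ[ℂ] ℂ) {r c : ℕ}
    (hJ : Fintype.card n + c ≤ r + finrank ℂ J)
    (hn : ∀ x ∈ J, (∀ i, φ i x = 0) → (hform G x x).re ≤ 0) :
    posDim G ⊤ + c ≤ r + Fintype.card ι := by
  have h1 := finrank_le_finrank_inf_ker_add (LinearMap.pi φ) J
  have h2 : NonposOn G (J ⊓ LinearMap.ker (LinearMap.pi φ)) := fun x hx =>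
    hn x hx.1 fun i => congrFun (LinearMap.mem_ker.1 hx.2) i
  have h3 := posDim_add_finrank_le le_top h2
  rw [finrank_top, finrank_fintype_fun_eq_card] at h3
  rw [finrank_fintype_fun_eq_card] at h1
  omega

/-- Inside K ∩ R^⊥, R being the radical of K₀, the orthogonal subspaces K₀ and K ∩ K₀^⊥ add their
indices. In passing to K, the isotropic R adds its dimension modulo K^⊥. -/
theorem posDim_inf_add_le {H : Matrix n n ℂ} (hH : H.IsHermitian) {K₀ K : Submodule ℂ (n → ℂ)}
    (h : K₀ ≤ K) :
    posDim H K₀ + posDim H (K ⊓ perp H K₀) + finrank ℂ (K₀ ⊓ perp H K₀ : Submodule ℂ (n → ℂ)) ≤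
      posDim H K + finrank ℂ (K₀ ⊓ perp H K : Submodule ℂ (n → ℂ)) := by
  set R := K₀ ⊓ perp H K₀ with hR
  have hK₀ : K₀ ≤ K ⊓ perp H R := le_inf h (hH.perp_comm inf_le_right)
  have h1 := posDim_add_posDim_le hH hK₀
    (inf_le_inf_left K (perp_anti inf_le_left : perp H K₀ ≤ perp H R))
    (inf_le_right : K ⊓ perp H K₀ ≤ perp H K₀)
  have h2 := posDim_add_finrank_le_posDim_add hH (T := R) (K' := K ⊓ perp H R) (K := K)
    (inf_le_left.trans hK₀) inf_le_left (hH.perp_comm inf_le_right)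
  have h3 : finrank ℂ (R ⊓ perp H K : Submodule ℂ (n → ℂ)) ≤
      finrank ℂ (K₀ ⊓ perp H K : Submodule ℂ (n → ℂ)) :=
    Submodule.finrank_mono (inf_le_inf_right _ inf_le_left)
  omega

/-- For a subspace `K₀` of `K` the form on `K`, restricted to the vectors orthogonal to the radical
of `K₀`, is the sum of the form on `K₀` and the form on the orthogonal complement of `K₀`. -/
theorem hform_eq_add_of_frames {H : Matrix n n ℂ} (hH : H.IsHermitian)
    {K₀ K : Submodule ℂ (n → ℂ)} (h : K₀ ≤ K) {ι ι' κ κ' : Type*} [Fintype ι] [Fintype ι']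
    [Fintype κ] [Fintype κ'] {e₀ : ι → n → ℂ} {f₀ : ι' → n → ℂ} {e : κ → n → ℂ} {f : κ' → n → ℂ}
    (he₀ : ∀ i, e₀ i ∈ K₀) (hf₀ : ∀ i, f₀ i ∈ K₀)
    (h₀ : ∀ x ∈ K₀, ∀ y ∈ perp H (K₀ ⊓ perp H K₀), hform H x y =
        ∑ i, star (hform H (e₀ i) x) * hform H (e₀ i) y -
          ∑ i, star (hform H (f₀ i) x) * hform H (f₀ i) y)
    (he : ∀ i, e i ∈ perp H K₀) (hf : ∀ i, f i ∈ perp H K₀)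
    (hL : ∀ x ∈ K ⊓ perp H K₀, ∀ y ∈ K ⊓ perp H K₀, hform H x y =
        ∑ i, star (hform H (e i) x) * hform H (e i) y -
          ∑ i, star (hform H (f i) x) * hform H (f i) y)
    {x y : n → ℂ} (hx : x ∈ perp H (K₀ ⊓ perp H K₀) ⊓ K)
    (hy : y ∈ perp H (K₀ ⊓ perp H K₀) ⊓ K) :
    hform H x y =
      (∑ i, star (hform H (e₀ i) x) * hform H (e₀ i) y -
          ∑ i, star (hform H (f₀ i) x) * hform H (f₀ i) y) +
      (∑ i, star (hform H (e i) x) * hform H (e i) y -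
          ∑ i, star (hform H (f i) x) * hform H (f i) y) := by
  have hdec : ∀ x ∈ perp H (K₀ ⊓ perp H K₀) ⊓ K,
      ∃ k ∈ K₀, ∃ l ∈ K ⊓ perp H K₀, x = k + l := by
    intro x hx
    -- The H-orthogonal projection of x to K₀ in terms of the signed frame; it exists because x is
    -- orthogonal to the radical of K₀.
    set k := ∑ i, hform H (e₀ i) x • e₀ i - ∑ i, hform H (f₀ i) x • f₀ i with hk
    have hkK : k ∈ K₀ := K₀.sub_mem (K₀.sum_mem fun i _ => K₀.smul_mem _ (he₀ i))
      (K₀.sum_mem fun i _ => K₀.smul_mem _ (hf₀ i))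
    refine ⟨k, hkK, x - k, ⟨K.sub_mem hx.2 (h hkK), fun z hz => ?_⟩, by abel⟩
    rw [hform_sub_right, h₀ z hz x hx.1, hk, hform_sub_right, hform_sum_right, hform_sum_right]
    simp only [hform_smul_right, hH.star_hform, mul_comm, sub_self]
  obtain ⟨k, hk, l, hl, rfl⟩ := hdec x hx
  obtain ⟨k', hk', l', hl', rfl⟩ := hdec y hy
  have c0 : ∀ {z : n → ℂ}, z ∈ K₀ → ∀ a, ∀ b ∈ perp H K₀, hform H z (a + b) = hform H z a :=
    fun hz a b hb => by rw [hform_add_right, hb _ hz, add_zero]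
  have c1 : ∀ {z : n → ℂ}, z ∈ perp H K₀ → ∀ a ∈ K₀, ∀ b, hform H z (a + b) = hform H z b :=
    fun hz a ha b => by
      rw [hform_add_right, hH.hform_eq_zero_comm.1 (hz a ha), zero_add]
  have hJ : K₀ ≤ perp H (K₀ ⊓ perp H K₀) := hH.perp_comm inf_le_right
  simp only [c0 (he₀ _) _ _ hl.2, c0 (he₀ _) _ _ hl'.2, c0 (hf₀ _) _ _ hl.2,
    c0 (hf₀ _) _ _ hl'.2, c1 (he _) _ hk, c1 (he _) _ hk', c1 (hf _) _ hk, c1 (hf _) _ hk']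
  rw [← h₀ k hk k' (hJ hk'), ← hL l hl l' hl', hform_add_left, c0 hk _ _ hl'.2, c1 hl.2 _ hk']

theorem exists_posDim_add_pert_le (B : Matrix n p ℂ) (F : Matrix n q ℂ) {H : Matrix n n ℂ}
    (hH : H.IsHermitian) : ∃ Z : Matrix p q ℂ,
      posDim (H + pert B F Z) ⊤ +
          finrank ℂ (leftKer B ⊓ leftKer F ⊓ perp H ⊤ : Submodule ℂ (n → ℂ)) ≤
        max (posDim H (leftKer B) + finrank ℂ
            (leftKer B ⊓ leftKer F ⊓ perp H (leftKer B) : Submodule ℂ (n → ℂ)))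
          (posDim H (leftKer F) + finrank ℂ
            (leftKer B ⊓ leftKer F ⊓ perp H (leftKer F) : Submodule ℂ (n → ℂ))) ∧
      posDim (-(H + pert B F Z)) ⊤ +
          finrank ℂ (leftKer B ⊓ leftKer F ⊓ perp H ⊤ : Submodule ℂ (n → ℂ)) ≤
        max (posDim (-H) (leftKer B) + finrank ℂ
            (leftKer B ⊓ leftKer F ⊓ perp H (leftKer B) : Submodule ℂ (n → ℂ)))
          (posDim (-H) (leftKer F) + finrank ℂ
            (leftKer B ⊓ leftKer F ⊓ perp H (leftKer F) : Submodule ℂ (n → ℂ))) := by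
  set K₁ := leftKer B
  set K₂ := leftKer F
  set K₀ := K₁ ⊓ K₂
  set R := K₀ ⊓ perp H K₀ with hR
  set J := perp H R with hJ
  set L₁ := K₁ ⊓ perp H K₀
  set L₂ := K₂ ⊓ perp H K₀
  -- Frames of L₁ and L₂ are padded to common lengths so that their members can be glued in pairs.
  -- This is the source of the maximum in the conclusion.
  set d := max (posDim H L₁) (posDim H L₂)
  set d' := max (posDim (-H) L₁) (posDim (-H) L₂)
  have hK₀J : K₀ ≤ J := hH.perp_comm inf_le_right
  obtain ⟨e₀, f₀, he₀, hf₀, h₀⟩ := exists_signed_frame hH K₀ le_rfl le_rfl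
  obtain ⟨e₁, f₁, he₁, hf₁, h₁⟩ := exists_signed_frame hH L₁ (d := d) (d' := d')
    (le_max_left _ _) (le_max_left _ _)
  obtain ⟨e₂, f₂, he₂, hf₂, h₂⟩ := exists_signed_frame hH L₂ (d := d) (d' := d')
    (le_max_right _ _) (le_max_right _ _)
  have hrad : ∀ L : Submodule ℂ (n → ℂ), L ≤ perp H (L ⊓ perp H L) := fun L =>
    hH.perp_comm inf_le_right
  have hglue : ∀ {a b : n → ℂ}, a ∈ L₁ → b ∈ L₂ → ∃ φ : (n → ℂ) →ₗ[ℂ] ℂ,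
      (∀ x ∈ K₁, φ x = hform H a x) ∧ ∀ x ∈ K₂, φ x = hform H b x := fun {a b} ha hb =>
    exists_functional_eq_eq (f := hformRight H a) (g := hformRight H b) fun x hx hx' => by
      rw [hformRight_apply, hformRight_apply, hH.hform_eq_zero_comm.1 (ha.2 x ⟨hx, hx'⟩),
        hH.hform_eq_zero_comm.1 (hb.2 x ⟨hx, hx'⟩)]
  choose φ hφ₁ hφ₂ using fun i => hglue (he₁ i) (he₂ i)
  choose ψ hψ₁ hψ₂ using fun i => hglue (hf₁ i) (hf₂ i)
  obtain ⟨M, hM, hMf⟩ := exists_isHermitian_hform_eq_sum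
    (Sum.elim (fun i => hformRight H (e₀ i)) φ)
  obtain ⟨M', hM', hMf'⟩ := exists_isHermitian_hform_eq_sum
    (Sum.elim (fun i => hformRight H (f₀ i)) ψ)
  have hΔ : ∀ x y, hform (M - M' - H) x y = hform M x y - hform M' x y - hform H x y :=
    fun x y => by simp only [hform, Matrix.sub_mulVec, dotProduct_sub]
  -- On J = R^⊥ the form M − M' agrees with H on K₁, on K₂ and against K₀, because the glued
  -- functionals restrict to the frames of Lᵢ on Kᵢ and vanish on K₀. So a perturbation turns H into
  -- M − M' on J. Its positive and negative squares bound both indices at once, up to codim J.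
  obtain ⟨Z, hZ⟩ := exists_pert_hform_eq_on B F ((hM.sub hM').sub hH) J
    (fun x hx y hy => by
      rw [hΔ, hMf, hMf', hform_eq_add_of_frames hH inf_le_left he₀ hf₀ h₀ (fun i => (he₁ i).2)
        (fun i => (hf₁ i).2) (fun x hx y hy => h₁ x hx y (hrad _ hy)) hx hy]
      simp only [Fintype.sum_sum_type, Sum.elim_inl, Sum.elim_inr, hformRight_apply, hφ₁ _ x hx.2,
        hφ₁ _ y hy.2, hψ₁ _ x hx.2, hψ₁ _ y hy.2]
      ring)
    (fun x hx y hy => by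
      rw [hΔ, hMf, hMf', hform_eq_add_of_frames hH inf_le_right he₀ hf₀ h₀ (fun i => (he₂ i).2)
        (fun i => (hf₂ i).2) (fun x hx y hy => h₂ x hx y (hrad _ hy)) hx hy]
      simp only [Fintype.sum_sum_type, Sum.elim_inl, Sum.elim_inr, hformRight_apply, hφ₂ _ x hx.2,
        hφ₂ _ y hy.2, hψ₂ _ x hx.2, hψ₂ _ y hy.2]
      ring)
    (fun x hx y hy => by
      have hxK : x ∈ K₀ := ⟨hx.1.2, hx.2⟩
      have z1 : ∀ i, φ i x = 0 := fun i => by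
        rw [hφ₁ i x hxK.1, hH.hform_eq_zero_comm.1 ((he₁ i).2 x hxK)]
      have z2 : ∀ i, ψ i x = 0 := fun i => by
        rw [hψ₁ i x hxK.1, hH.hform_eq_zero_comm.1 ((hf₁ i).2 x hxK)]
      rw [hΔ, hMf, hMf', h₀ x hxK y hy]
      simp only [Fintype.sum_sum_type, Sum.elim_inl, Sum.elim_inr, hformRight_apply, z1, z2,
        star_zero, zero_mul, Finset.sum_const_zero, add_zero, sub_self])
  have hG : ∀ x ∈ J, hform (H + pert B F Z) x x = hform M x x - hform M' x x := fun x hx => by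
    rw [hform_matrix_add, hZ x hx x hx, hΔ]; ring
  have hsq : ∀ {ι : Type} [Fintype ι] (v : ι → ℂ), 0 ≤ (∑ i, star (v i) * v i).re :=
    fun v => by
      rw [Complex.re_sum]
      exact Finset.sum_nonneg fun i _ => by
        simp only [Complex.star_def, Complex.mul_re, Complex.conj_re, Complex.conj_im]
        nlinarith [mul_self_nonneg (v i).re, mul_self_nonneg (v i).im]
  have hcodim : Fintype.card n + finrank ℂ (K₀ ⊓ perp H ⊤ : Submodule ℂ (n → ℂ)) ≤
      finrank ℂ R + finrank ℂ J := by
    refine le_trans (Nat.add_le_add_left (Submodule.finrank_mono ?_) _)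
      (finrank_add_finrank_inf_ker_le H hH R)
    exact le_inf (inf_le_inf_left _ (perp_anti le_top)) inf_le_right
  have hp := posDim_top_add_le (G := H + pert B F Z)
    (Sum.elim (fun i => hformRight H (e₀ i)) φ) hcodim fun x hx hz => by
    rw [hG x hx, hMf, Complex.sub_re, hMf']
    have := hsq fun i => Sum.elim (fun i => hformRight H (f₀ i)) ψ i x
    simp only [hz, mul_zero, Finset.sum_const_zero, Complex.zero_re]
    linarith
  have hm := posDim_top_add_le (G := -(H + pert B F Z))
    (Sum.elim (fun i => hformRight H (f₀ i)) ψ) hcodim fun x hx hz => by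
    rw [hform_neg, hG x hx, hMf', Complex.neg_re, Complex.sub_re, hMf]
    have := hsq fun i => Sum.elim (fun i => hformRight H (e₀ i)) φ i x
    simp only [hz, mul_zero, Finset.sum_const_zero, Complex.zero_re]
    linarith
  rw [Fintype.card_sum, Fintype.card_fin, Fintype.card_fin] at hp hm
  -- So far the index plus dim(K₀ ∩ ker H) is at most dim R + i(K₀) + max i(Lᵢ). These inequalities
  -- replace dim R + i(K₀) + i(Lᵢ) by i(Kᵢ) + dim(K₀ ∩ Kᵢ^⊥).
  have b1 : posDim H K₀ + posDim H L₁ + finrank ℂ R ≤ _ :=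
    posDim_inf_add_le hH (K₀ := K₀) (K := K₁) inf_le_left
  have b2 : posDim H K₀ + posDim H L₂ + finrank ℂ R ≤ _ :=
    posDim_inf_add_le hH (K₀ := K₀) (K := K₂) inf_le_right
  have b3 := posDim_inf_add_le hH.neg (K₀ := K₀) (K := K₁) inf_le_left
  have b4 := posDim_inf_add_le hH.neg (K₀ := K₀) (K := K₂) inf_le_right
  rw [perp_neg, perp_neg] at b3 b4
  change posDim (-H) K₀ + posDim (-H) L₁ + finrank ℂ R ≤ _ at b3
  change posDim (-H) K₀ + posDim (-H) L₂ + finrank ℂ R ≤ _ at b4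
  refine ⟨Z, ?_, ?_⟩
  · omega
  · omega

end Minimal

/-! ### Inertia and ranks of the block matrices -/

section Inertia

open Module

variable {n p : Type*} [Fintype n] [Fintype p]

theorem posDim_top_le_card [DecidableEq n] {H : Matrix n n ℂ} (hH : H.IsHermitian) :
    posDim H ⊤ ≤ Fintype.card {i // 0 < hH.eigenvalues i} ∧
      posDim (-H) ⊤ ≤ Fintype.card {i // hH.eigenvalues i < 0} := by
  let U : Matrix n n ℂ := (hH.eigenvectorUnitary).1
  have hform_eq : ∀ x, (hform H x x).re =
      ∑ i, hH.eigenvalues i * Complex.normSq ((Uᴴ *ᵥ x) i) := fun x => by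
    have h1 : H = Uᴴᴴ * Matrix.diagonal (fun i => (hH.eigenvalues i : ℂ)) * Uᴴ := by
      conv_lhs => rw [hH.spectral_theorem, Unitary.conjStarAlgAut_apply]
      rw [Matrix.conjTranspose_conjTranspose]
      rfl
    conv_lhs => rw [h1, hform_conj_mul, hform, dotProduct, Complex.re_sum]
    refine Finset.sum_congr rfl fun i _ => ?_
    rw [Matrix.mulVec_diagonal]
    simp [Complex.normSq_apply]
    ring
  let φ : n → (n → ℂ) →ₗ[ℂ] ℂ := fun i => LinearMap.proj i ∘ₗ Uᴴ.mulVecLin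
  have hφ : ∀ i x, φ i x = (Uᴴ *ᵥ x) i := fun i x => rfl
  have hJ : Fintype.card n + 0 ≤ 0 + finrank ℂ (⊤ : Submodule ℂ (n → ℂ)) := by
    rw [finrank_top, finrank_fintype_fun_eq_card]; omega
  constructor
  · have := posDim_top_add_le (G := H) (fun i : {i // 0 < hH.eigenvalues i} => φ i) hJ
      fun x _ hx => by
        rw [hform_eq]
        refine Finset.sum_nonpos fun i _ => ?_
        by_cases hi : 0 < hH.eigenvalues i
        · rw [← hφ, hx ⟨i, hi⟩]; simp
        · exact mul_nonpos_of_nonpos_of_nonneg (not_lt.1 hi) (Complex.normSq_nonneg _)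
    simpa using this
  · have := posDim_top_add_le (G := -H) (fun i : {i // hH.eigenvalues i < 0} => φ i) hJ
      fun x _ hx => by
        rw [hform_neg, Complex.neg_re, hform_eq, neg_nonpos]
        refine Finset.sum_nonneg fun i _ => ?_
        by_cases hi : hH.eigenvalues i < 0
        · rw [← hφ, hx ⟨i, hi⟩]; simp
        · exact mul_nonneg (not_lt.1 hi) (Complex.normSq_nonneg _)
    simpa using this

theorem posInertia_eq_card [DecidableEq n] {H : Matrix n n ℂ} (hH : H.IsHermitian) :
    posInertia H = Fintype.card {i // 0 < hH.eigenvalues i} := by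
  classical
  rw [posInertia, hH.roots_charpoly_eq_eigenvalues, Multiset.countP_map, Fintype.card_subtype,
    Finset.card]
  simp

theorem negInertia_eq_card [DecidableEq n] {H : Matrix n n ℂ} (hH : H.IsHermitian) :
    negInertia H = Fintype.card {i // hH.eigenvalues i < 0} := by
  classical
  rw [negInertia, hH.roots_charpoly_eq_eigenvalues, Multiset.countP_map, Fintype.card_subtype,
    Finset.card]
  simp only [Finset.filter_val]
  refine congrArg _ (Multiset.filter_congr fun i _ => ?_)
  simp only [Function.comp_apply, Complex.coe_algebraMap]
  norm_cast

/-- Each index is at most the number of eigenvalues of its sign, and both pairs add up to the rank,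
so both inequalities are equalities. -/
theorem inertia_eq_posDim [DecidableEq n] {H : Matrix n n ℂ} (hH : H.IsHermitian) :
    posInertia H = posDim H ⊤ ∧ negInertia H = posDim (-H) ⊤ := by
  have h1 := posDim_top_le_card hH
  have h2 := rank_eq_posDim_add hH
  have h3 : Fintype.card {i // hH.eigenvalues i ≠ 0} =
      Fintype.card {i // 0 < hH.eigenvalues i} + Fintype.card {i // hH.eigenvalues i < 0} := by
    rw [← Fintype.card_subtype_or_disjoint]
    · exact Fintype.card_congr (Equiv.subtypeEquivRight fun i => by
        rw [ne_iff_lt_or_gt, or_comm])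
    · rw [Pi.disjoint_iff]
      intro i
      rw [Prop.disjoint_iff]
      exact fun h => lt_asymm h.1 h.2
  rw [hH.rank_eq_card_non_zero_eigs, h3] at h2
  rw [posInertia_eq_card hH, negInertia_eq_card hH]
  omega

theorem finrank_leftKer_add_rank (B : Matrix n p ℂ) :
    finrank ℂ (leftKer B) + B.rank = Fintype.card n := by
  rw [← Matrix.rank_conjTranspose, leftKer, finrank_ker_mulVecLin_add_rank]

theorem hform_fromBlocks (A : Matrix n n ℂ) (B : Matrix n p ℂ) (z w : n ⊕ p → ℂ) :
    hform (Matrix.fromBlocks A B Bᴴ 0) z w = hform A (z ∘ Sum.inl) (w ∘ Sum.inl) +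
      star (Bᴴ *ᵥ (z ∘ Sum.inl)) ⬝ᵥ (w ∘ Sum.inr) +
      star (z ∘ Sum.inr) ⬝ᵥ (Bᴴ *ᵥ (w ∘ Sum.inl)) := by
  rw [hform, Matrix.fromBlocks_mulVec, ← Sum.elim_comp_inl_inr (star z), sumElim_dotProduct_sumElim,
    Matrix.zero_mulVec, add_zero, dotProduct_add, Matrix.star_mulVec,
    Matrix.conjTranspose_conjTranspose, ← Matrix.dotProduct_mulVec]
  rfl

/-- Where B*x = 0 the block form at (x, y) is just A(x, x); this subspace is cut out by r(B)
conditions, whence ≤. Conversely the isotropic space 0 ⊕ ℂᵖ is orthogonal to it and meets the kernel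
of the block matrix in a copy of ker B, so it contributes r(B). -/
theorem posDim_fromBlocks [DecidableEq n] [DecidableEq p] {A : Matrix n n ℂ} (hA : A.IsHermitian)
    (B : Matrix n p ℂ) :
    posDim (Matrix.fromBlocks A B Bᴴ 0) ⊤ = B.rank + posDim A (leftKer B) := by
  set M := Matrix.fromBlocks A B Bᴴ 0 with hMdef
  have hM : M.IsHermitian := Matrix.IsHermitian.fromBlocks hA rfl Matrix.isHermitian_zero
  let fst : (n ⊕ p → ℂ) →ₗ[ℂ] (n → ℂ) := LinearMap.funLeft ℂ ℂ Sum.inl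
  let snd : (n ⊕ p → ℂ) →ₗ[ℂ] (p → ℂ) := LinearMap.funLeft ℂ ℂ Sum.inr
  have hfs : ∀ z, fst z = 0 → snd z = 0 → z = 0 := fun z h1 h2 => by
    ext (i | i)
    · exact congrFun h1 i
    · exact congrFun h2 i
  have hform_eq : ∀ z w, hform M z w = hform A (fst z) (fst w) +
      star (Bᴴ *ᵥ fst z) ⬝ᵥ snd w + star (snd z) ⬝ᵥ (Bᴴ *ᵥ fst w) := hform_fromBlocks A B
  let g : (n ⊕ p → ℂ) →ₗ[ℂ] (p → ℂ) := Bᴴ.mulVecLin ∘ₗ fst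
  have hg : ∀ z, z ∈ LinearMap.ker g ↔ Bᴴ *ᵥ fst z = 0 := fun z => Iff.rfl
  apply le_antisymm
  · refine posDim_le fun P _ hP => ?_
    have h1 := finrank_map_add_finrank_inf_ker g P
    have h2 : finrank ℂ (P.map g) ≤ B.rank := by
      rw [← Matrix.rank_conjTranspose, Matrix.rank]
      refine Submodule.finrank_mono ?_
      rintro _ ⟨z, -, rfl⟩
      exact ⟨fst z, rfl⟩
    have hzero : ∀ z ∈ LinearMap.ker g, hform M z z = hform A (fst z) (fst z) := fun z hz => by
      rw [hform_eq, (hg z).1 hz]; simp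
    have h3 : finrank ℂ ((P ⊓ LinearMap.ker g).map fst) =
        finrank ℂ (P ⊓ LinearMap.ker g : Submodule ℂ (n ⊕ p → ℂ)) := by
      refine finrank_map_of_inf_ker_eq_bot fst _ fun z hz h0 => ?_
      by_contra hne
      have := hP z hz.1 hne
      rw [hzero z hz.2, h0, hform_zero_left] at this
      exact lt_irrefl _ this
    have h4 : finrank ℂ ((P ⊓ LinearMap.ker g).map fst) ≤ posDim A (leftKer B) := by
      refine finrank_le_posDim ?_ ?_
      · rintro _ ⟨z, hz, rfl⟩
        exact (hz : z ∈ P ⊓ LinearMap.ker g).2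
      · rintro _ ⟨z, hz, rfl⟩ h0
        rw [← hzero z hz.2]
        exact hP z hz.1 (by rintro rfl; simp at h0)
    omega
  · have hT : LinearMap.ker fst ≤ LinearMap.ker g := fun z hz => by
      rw [hg, LinearMap.mem_ker.1 hz, Matrix.mulVec_zero]
    have h1 := posDim_add_finrank_le_posDim_add hM hT le_top (fun t ht x hx => by
      rw [hform_eq, (hg x).1 hx, LinearMap.mem_ker.1 ht]; simp)
    have h2 : finrank ℂ (LinearMap.ker fst) = Fintype.card p := by
      have := LinearMap.finrank_range_add_finrank_ker fst
      rw [LinearMap.range_eq_top.2 (LinearMap.funLeft_surjective_of_injective ℂ ℂ _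
        Sum.inl_injective), finrank_top, finrank_fintype_fun_eq_card, finrank_fintype_fun_eq_card,
        Fintype.card_sum] at this
      omega
    have h3 : finrank ℂ (LinearMap.ker fst ⊓ perp M ⊤ : Submodule ℂ (n ⊕ p → ℂ)) ≤
        finrank ℂ (LinearMap.ker B.mulVecLin) := by
      rw [← finrank_map_of_inf_ker_eq_bot snd (LinearMap.ker fst ⊓ perp M ⊤) fun z hz h0 =>
        hfs z hz.1 h0]
      refine Submodule.finrank_mono ?_
      rintro _ ⟨z, hz, rfl⟩
      rw [perp_top] at hz
      have := congrArg (· ∘ Sum.inl) (LinearMap.mem_ker.1 hz.2)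
      have h0 : z ∘ Sum.inl = 0 := hz.1
      simp only [Matrix.mulVecLin_apply, hMdef, Matrix.fromBlocks_mulVec, Sum.elim_comp_inl, h0,
        Matrix.mulVec_zero, zero_add] at this
      exact this
    have h4 := finrank_ker_mulVecLin_add_rank B
    have h5 : posDim A (leftKer B) ≤ posDim M (LinearMap.ker g) := by
      refine posDim_le fun P hPB hP => ?_
      let ι : (n → ℂ) →ₗ[ℂ] (n ⊕ p → ℂ) :=
        { toFun := fun x => Sum.elim x 0
          map_add' := fun x y => by ext (i | i) <;> simp
          map_smul' := fun c x => by ext (i | i) <;> simp }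
      have hι : ∀ x, fst (ι x) = x := fun x => rfl
      have hι' : ∀ x, snd (ι x) = 0 := fun x => rfl
      rw [← finrank_map_of_inf_ker_eq_bot ι P fun x _ h0 => by rw [← hι x, h0, map_zero]]
      refine finrank_le_posDim ?_ ?_
      · rintro _ ⟨x, hx, rfl⟩
        exact hPB hx
      · rintro _ ⟨x, hx, rfl⟩ h0
        rw [hform_eq, hι, hι']
        simpa using hP x hx (by rintro rfl; simp at h0)
    omega

theorem posDim_mul_mul_conjTranspose [DecidableEq n] [DecidableEq p] (H : Matrix p p ℂ)
    (B : Matrix n p ℂ) :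
    posDim (B * H * Bᴴ) ⊤ = posDim H (LinearMap.range Bᴴ.mulVecLin) := by
  have hform_eq : ∀ x y, hform (B * H * Bᴴ) x y = hform H (Bᴴ *ᵥ x) (Bᴴ *ᵥ y) := fun x y => by
    rw [← hform_conj_mul, Matrix.conjTranspose_conjTranspose]
  apply le_antisymm
  · refine posDim_le fun P _ hP => ?_
    rw [← finrank_map_of_inf_ker_eq_bot Bᴴ.mulVecLin P fun x hx h0 => by
      by_contra hne
      have := hP x hx hne
      rw [hform_eq, ← Matrix.mulVecLin_apply, h0, hform_zero_left] at this
      exact lt_irrefl _ this]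
    refine finrank_le_posDim ?_ ?_
    · rintro _ ⟨x, hx, rfl⟩
      exact ⟨x, rfl⟩
    · rintro _ ⟨x, hx, rfl⟩ h0
      rw [Matrix.mulVecLin_apply, ← hform_eq]
      exact hP x hx (by rintro rfl; simp at h0)
  · refine posDim_le fun P hPB hP => ?_
    obtain ⟨G, hG⟩ := exists_mul_mul_self_eq Bᴴ
    have hGx : ∀ x ∈ P, Bᴴ *ᵥ G *ᵥ x = x := fun x hx => by
      obtain ⟨y, rfl⟩ := hPB hx
      rw [Matrix.mulVecLin_apply, Matrix.mulVec_mulVec, Matrix.mulVec_mulVec, hG]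
    rw [← finrank_map_of_inf_ker_eq_bot G.mulVecLin P fun x hx h0 => by
      rw [← hGx x hx, ← Matrix.mulVecLin_apply G, h0, Matrix.mulVec_zero]]
    refine finrank_le_posDim le_top ?_
    rintro _ ⟨x, hx, rfl⟩ h0
    rw [hform_eq, Matrix.mulVecLin_apply, hGx x hx]
    exact hP x hx (by rintro rfl; simp at h0)

theorem range_mulVecLin_eq_perp_one [DecidableEq n] (B : Matrix n p ℂ) :
    LinearMap.range B.mulVecLin = perp 1 (leftKer B) := by
  refine Submodule.eq_of_le_of_finrank_le ?_ ?_
  · rintro _ ⟨y, rfl⟩ x hx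
    rw [hform, Matrix.one_mulVec, Matrix.mulVecLin_apply, Matrix.dotProduct_mulVec,
      ← Matrix.conjTranspose_conjTranspose B, ← Matrix.star_mulVec, mem_leftKer.1 hx, star_zero,
      zero_dotProduct]
  · have h1 := finrank_add_le_of_inf_eq_bot (le_top : leftKer B ≤ ⊤)
      (le_top : perp 1 (leftKer B) ≤ ⊤) fun x hx hx' => by
        have := hx' x hx
        rwa [hform, Matrix.one_mulVec, dotProduct_star_self_eq_zero] at this
    have h2 := finrank_leftKer_add_rank B
    rw [finrank_top, finrank_fintype_fun_eq_card] at h1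
    rw [Matrix.rank] at h2
    omega

/-- F is a projection onto ker B. Then BF = 0 gives ran B* ⊆ ker F*, and the dimensions agree. -/
theorem exists_leftKer_eq_range [DecidableEq n] (B : Matrix n n ℂ) :
    ∃ F : Matrix n n ℂ, B * F = 0 ∧ leftKer F = LinearMap.range Bᴴ.mulVecLin := by
  obtain ⟨π, hπ, hπ', -⟩ := exists_projection_map_le (LinearMap.ker B.mulVecLin) ⊥
  set F := LinearMap.toMatrix' π
  have hF : ∀ x, F *ᵥ x = π x := fun x => LinearMap.toMatrix'_mulVec _ _
  have hBF : B * F = 0 := Matrix.toLin'.injective (LinearMap.ext fun x => by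
    rw [Matrix.toLin'_apply, ← Matrix.mulVec_mulVec, hF, map_zero]
    exact hπ x)
  refine ⟨F, hBF, (Submodule.eq_of_le_of_finrank_le ?_ ?_).symm⟩
  · rintro _ ⟨y, rfl⟩
    rw [mem_leftKer, Matrix.mulVecLin_apply, Matrix.mulVec_mulVec, ← Matrix.conjTranspose_mul,
      hBF, Matrix.conjTranspose_zero, Matrix.zero_mulVec]
  · have h1 := finrank_leftKer_add_rank F
    have h2 := finrank_ker_mulVecLin_add_rank B
    have h3 : finrank ℂ (LinearMap.ker B.mulVecLin) ≤ F.rank := by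
      refine Submodule.finrank_mono fun x hx => ⟨x, ?_⟩
      rw [Matrix.mulVecLin_apply, hF, hπ' x hx]
    have h4 : finrank ℂ (LinearMap.range Bᴴ.mulVecLin) = B.rank := B.rank_conjTranspose
    omega

theorem posDim_top_add_finrank_le (H : Matrix n n ℂ) (K : Submodule ℂ (n → ℂ)) :
    posDim H ⊤ + finrank ℂ K ≤ posDim H K + Fintype.card n := by
  obtain ⟨P, -, hP, hd⟩ := exists_finrank_eq_posDim H ⊤
  have h1 := Submodule.finrank_sup_add_finrank_inf_eq P K
  have h2 := Submodule.finrank_le (P ⊔ K)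
  have h3 := finrank_le_posDim (inf_le_right : P ⊓ K ≤ K) fun x hx => hP x hx.1
  rw [finrank_fintype_fun_eq_card] at h2
  omega

theorem posDim_add_finrank_le_top {H : Matrix n n ℂ} (hH : H.IsHermitian)
    {K₀ K : Submodule ℂ (n → ℂ)} (h : K₀ ≤ K) :
    posDim H K + finrank ℂ (K₀ ⊓ perp H K : Submodule ℂ (n → ℂ)) ≤
      posDim H ⊤ + finrank ℂ (K₀ ⊓ perp H ⊤ : Submodule ℂ (n → ℂ)) := by
  refine (posDim_add_finrank_le_posDim_add hH (inf_le_left.trans h) le_top inf_le_right).trans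
    (Nat.add_le_add_left (Submodule.finrank_mono (inf_le_inf_right _ inf_le_left)) _)

end Inertia

/-! ### Ranks of the block matrices as dimensions of subspaces of ker B* ∩ ran B* -/

section BlockRanks

open Module

variable {m : ℕ}

theorem rowBlockRank_add_finrank (P Q : Matrix (Fin m) (Fin m) ℂ) :
    rowBlockRank P Q +
      finrank ℂ (LinearMap.ker Pᴴ.mulVecLin ⊓ LinearMap.ker Qᴴ.mulVecLin :
        Submodule ℂ (Fin m → ℂ)) = m := by
  have h1 := finrank_leftKer_add_rank (Matrix.fromCols P Q)
  have h2 : leftKer (Matrix.fromCols P Q) =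
      LinearMap.ker Pᴴ.mulVecLin ⊓ LinearMap.ker Qᴴ.mulVecLin := by
    ext x
    rw [mem_leftKer, Matrix.conjTranspose_fromCols_eq_fromRows_conjTranspose,
      Matrix.fromRows_mulVec, Submodule.mem_inf, LinearMap.mem_ker, LinearMap.mem_ker,
      Matrix.mulVecLin_apply, Matrix.mulVecLin_apply]
    constructor
    · intro h
      exact ⟨congrArg (· ∘ Sum.inl) h, congrArg (· ∘ Sum.inr) h⟩
    · rintro ⟨h, h'⟩
      rw [h, h']
      ext (i | i) <;> rfl
  rw [h2, Fintype.card_fin] at h1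
  rw [rowBlockRank, add_comm]
  exact h1

variable {A B C X : Matrix (Fin m) (Fin m) ℂ}

/-- The left kernel of [B², P] is the preimage of ker B* ∩ S under B*, of dimension dim ker B* +
dim(ker B* ∩ ran B* ∩ S). -/
theorem rowBlockRank_add_of_comap {P : Matrix (Fin m) (Fin m) ℂ}
    {S : Submodule ℂ (Fin m → ℂ)}
    (h : ∀ y, Bᴴ *ᵥ Bᴴ *ᵥ y = 0 → (Pᴴ *ᵥ y = 0 ↔ Bᴴ *ᵥ y ∈ S)) :
    rowBlockRank (B ^ 2) P +
      finrank ℂ (leftKer B ⊓ LinearMap.range Bᴴ.mulVecLin ⊓ S : Submodule ℂ (Fin m → ℂ)) =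
        B.rank := by
  have h1 := rowBlockRank_add_finrank (B ^ 2) P
  have h2 : LinearMap.ker (B ^ 2)ᴴ.mulVecLin ⊓ LinearMap.ker Pᴴ.mulVecLin =
      (leftKer B ⊓ S).comap Bᴴ.mulVecLin := by
    ext y
    simp only [Submodule.mem_inf, LinearMap.mem_ker, Submodule.mem_comap, Matrix.mulVecLin_apply,
      mem_leftKer, pow_two, Matrix.conjTranspose_mul, ← Matrix.mulVec_mulVec]
    exact and_congr_right (h y)
  have h3 := finrank_leftKer_add_rank B
  rw [h2, finrank_comap_eq, ← inf_assoc, inf_comm (LinearMap.range _)] at h1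
  rw [Fintype.card_fin] at h3
  change _ + (finrank ℂ (leftKer B) + _) = _ at h1
  omega

theorem mul_conjTranspose_eq (hX : B * X * Bᴴ = C) :
    (A - B * X - X * Bᴴ) * Bᴴ = A * Bᴴ - C - X * (Bᴴ * Bᴴ) := by
  rw [Matrix.sub_mul, Matrix.sub_mul, hX, Matrix.mul_assoc X]

theorem rowBlockRank_add_inf_perp_top (hA : A.IsHermitian) (hC : C.IsHermitian)
    (hX : B * X * Bᴴ = C) :
    rowBlockRank (B ^ 2) (C - B * A) +
      finrank ℂ (leftKer B ⊓ LinearMap.range Bᴴ.mulVecLin ⊓ perp (A - B * X - X * Bᴴ) ⊤ :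
        Submodule ℂ (Fin m → ℂ)) = B.rank := by
  refine rowBlockRank_add_of_comap fun y hy => ?_
  rw [perp_top, LinearMap.mem_ker, Matrix.mulVecLin_apply, Matrix.mulVec_mulVec,
    mul_conjTranspose_eq hX, Matrix.conjTranspose_sub, Matrix.conjTranspose_mul, hA.eq, hC.eq,
    Matrix.sub_mulVec, Matrix.sub_mulVec, Matrix.sub_mulVec, ← Matrix.mulVec_mulVec y X,
    ← Matrix.mulVec_mulVec y Bᴴ, hy, Matrix.mulVec_zero, sub_zero, sub_eq_zero, sub_eq_zero,
    eq_comm]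

theorem mem_perp_range_iff {H : Matrix (Fin m) (Fin m) ℂ} {y : Fin m → ℂ} :
    Bᴴ *ᵥ y ∈ perp H (LinearMap.range Bᴴ.mulVecLin) ↔ (B * (H * Bᴴ)) *ᵥ y = 0 := by
  have hform_eq : ∀ x y, hform (B * (H * Bᴴ)) x y = hform H (Bᴴ *ᵥ x) (Bᴴ *ᵥ y) := fun x y => by
    rw [← hform_conj_mul, Matrix.conjTranspose_conjTranspose, Matrix.mul_assoc]
  constructor
  · intro h
    exact hform_eq_zero_of_forall_left fun x => by rw [hform_eq]; exact h _ ⟨x, rfl⟩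
  · rintro h _ ⟨x, rfl⟩
    rw [Matrix.mulVecLin_apply, ← hform_eq, hform, h, dotProduct_zero]

theorem rowBlockRank_add_inf_perp_range (hA : A.IsHermitian) (hC : C.IsHermitian)
    (hX : B * X * Bᴴ = C) :
    rowBlockRank (B ^ 2) (C * Bᴴ - B * A * Bᴴ) +
      finrank ℂ (leftKer B ⊓ LinearMap.range Bᴴ.mulVecLin ⊓
        perp (A - B * X - X * Bᴴ) (LinearMap.range Bᴴ.mulVecLin) :
        Submodule ℂ (Fin m → ℂ)) = B.rank := by
  refine rowBlockRank_add_of_comap fun y hy => ?_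
  rw [mem_perp_range_iff, mul_conjTranspose_eq hX]
  simp only [Matrix.conjTranspose_sub, Matrix.conjTranspose_mul, hA.eq, hC.eq,
    Matrix.conjTranspose_conjTranspose, Matrix.sub_mulVec, Matrix.mulVec_sub,
    ← Matrix.mulVec_mulVec, hy, Matrix.mulVec_zero, sub_zero]
  rw [sub_eq_zero, sub_eq_zero, eq_comm]

theorem rowBlockRank_neg (P Q : Matrix (Fin m) (Fin m) ℂ) :
    rowBlockRank P (-Q) = rowBlockRank P Q := by
  have h1 := rowBlockRank_add_finrank P Q
  have h2 := rowBlockRank_add_finrank P (-Q)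
  have h3 : LinearMap.ker (-Q)ᴴ.mulVecLin = LinearMap.ker Qᴴ.mulVecLin := by
    ext x
    simp
  rw [h3] at h2
  omega

/-- A pair (y, w) is in the left kernel of M₂ when B*B*y = 0 and AB*y = −Bw. For such y, HB*y and
AB*y differ by an element of ran B = (ker B*)^⊥ (standard inner product), so a suitable w exists
exactly when B*y is H-orthogonal to ker B*. The fibres are translates of ker B. -/
theorem rank_blockM₂_add (hA : A.IsHermitian) :
    (blockM₂ A B).rank +
      finrank ℂ (leftKer B ⊓ LinearMap.range Bᴴ.mulVecLin ⊓
        perp (A - B * X - X * Bᴴ) (leftKer B) : Submodule ℂ (Fin m → ℂ)) = 2 * B.rank := by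
  set H := A - B * X - X * Bᴴ with hH
  have h1 := finrank_leftKer_add_rank (blockM₂ A B)
  have hmem : ∀ z, z ∈ leftKer (blockM₂ A B) ↔
      A *ᵥ Bᴴ *ᵥ (z ∘ Sum.inl) + B *ᵥ (z ∘ Sum.inr) = 0 ∧ Bᴴ *ᵥ Bᴴ *ᵥ (z ∘ Sum.inl) = 0 := by
    intro z
    rw [mem_leftKer, blockM₂, Matrix.fromBlocks_conjTranspose, Matrix.fromBlocks_mulVec]
    simp only [Matrix.conjTranspose_mul, Matrix.conjTranspose_conjTranspose, pow_two, hA.eq,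
      ← Matrix.mulVec_mulVec, Matrix.conjTranspose_zero, Matrix.zero_mulVec, add_zero]
    constructor
    · intro h
      exact ⟨congrArg (· ∘ Sum.inl) h, congrArg (· ∘ Sum.inr) h⟩
    · rintro ⟨h, h'⟩
      rw [h, h']
      ext (i | i) <;> rfl
  let fst : (Fin m ⊕ Fin m → ℂ) →ₗ[ℂ] (Fin m → ℂ) := LinearMap.funLeft ℂ ℂ Sum.inl
  let snd : (Fin m ⊕ Fin m → ℂ) →ₗ[ℂ] (Fin m → ℂ) := LinearMap.funLeft ℂ ℂ Sum.inr
  have h2 := finrank_map_add_finrank_inf_ker fst (leftKer (blockM₂ A B))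
  have h3 : (leftKer (blockM₂ A B)).map fst =
      (leftKer B ⊓ perp H (leftKer B)).comap Bᴴ.mulVecLin := by
    have hrange : ∀ y, Bᴴ *ᵥ y ∈ perp H (leftKer B) ↔
        H *ᵥ Bᴴ *ᵥ y ∈ LinearMap.range B.mulVecLin := fun y => by
      rw [range_mulVecLin_eq_perp_one]
      refine forall₂_congr fun x _ => ?_
      rw [hform, hform, Matrix.one_mulVec]
    have hHy : ∀ y, Bᴴ *ᵥ Bᴴ *ᵥ y = 0 →
        H *ᵥ Bᴴ *ᵥ y = A *ᵥ Bᴴ *ᵥ y - B *ᵥ X *ᵥ Bᴴ *ᵥ y := fun y hy => by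
      rw [hH, Matrix.sub_mulVec, Matrix.sub_mulVec, ← Matrix.mulVec_mulVec _ X, hy,
        Matrix.mulVec_zero, sub_zero, ← Matrix.mulVec_mulVec _ B]
    ext y
    constructor
    · rintro ⟨z, hz, rfl⟩
      obtain ⟨hz1, hz2⟩ := (hmem z).1 hz
      refine ⟨hz2, (hrange _).2 ⟨-(z ∘ Sum.inr) - X *ᵥ Bᴴ *ᵥ (z ∘ Sum.inl), ?_⟩⟩
      have : A *ᵥ Bᴴ *ᵥ (z ∘ Sum.inl) = -(B *ᵥ (z ∘ Sum.inr)) := eq_neg_of_add_eq_zero_left hz1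
      rw [Matrix.mulVecLin_apply, Matrix.mulVec_sub, Matrix.mulVec_neg, ← this]
      exact (hHy _ hz2).symm
    · rintro ⟨hy1, hy2⟩
      obtain ⟨w, hw⟩ := (hrange y).1 hy2
      rw [hHy y hy1, Matrix.mulVecLin_apply] at hw
      refine ⟨Sum.elim y (-(w + X *ᵥ Bᴴ *ᵥ y)), (hmem _).2 ⟨?_, hy1⟩, rfl⟩
      rw [Sum.elim_comp_inl, Sum.elim_comp_inr, Matrix.mulVec_neg, Matrix.mulVec_add, hw]
      abel
  have h4 : finrank ℂ (leftKer (blockM₂ A B) ⊓ LinearMap.ker fst :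
      Submodule ℂ (Fin m ⊕ Fin m → ℂ)) = finrank ℂ (LinearMap.ker B.mulVecLin) := by
    rw [← finrank_map_of_inf_ker_eq_bot snd _ fun z hz h0 => by
      ext (i | i)
      · exact congrFun hz.2 i
      · exact congrFun h0 i]
    have h5 : (leftKer (blockM₂ A B) ⊓ LinearMap.ker fst).map snd = LinearMap.ker B.mulVecLin := by
      ext w
      constructor
      · rintro ⟨z, ⟨hz, hz0⟩, rfl⟩
        have h0 : z ∘ Sum.inl = 0 := hz0
        have := ((hmem z).1 hz).1
        rw [h0, Matrix.mulVec_zero, Matrix.mulVec_zero, zero_add] at this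
        exact this
      · intro hw
        refine ⟨Sum.elim 0 w, ⟨(hmem _).2 ?_, rfl⟩, rfl⟩
        rw [Sum.elim_comp_inl, Sum.elim_comp_inr, Matrix.mulVec_zero, Matrix.mulVec_zero,
          Matrix.mulVec_zero, zero_add]
        exact ⟨hw, rfl⟩
    rw [h5]
  have h5 := finrank_ker_mulVecLin_add_rank B
  have h6 := finrank_leftKer_add_rank B
  rw [h3, finrank_comap_eq, ← inf_assoc, inf_comm (LinearMap.range _), h4] at h2
  change (finrank ℂ (leftKer B) + _) + _ = _ at h2
  rw [Fintype.card_sum, Fintype.card_fin] at h1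
  rw [Fintype.card_fin] at h5 h6
  omega

end BlockRanks

/-! ### The main theorem -/

section Main

open Module

variable {m : ℕ} {A B C X : Matrix (Fin m) (Fin m) ℂ}

theorem isHermitian_sub_sub (hA : A.IsHermitian) (hX : X.IsHermitian) :
    (A - B * X - X * Bᴴ).IsHermitian := by
  simp only [Matrix.IsHermitian, Matrix.conjTranspose_sub, Matrix.conjTranspose_mul,
    Matrix.conjTranspose_conjTranspose, hA.eq, hX.eq]
  abel

theorem inertia_blockM₁ (hA : A.IsHermitian) :
    posInertia (blockM₁ A B) = B.rank + posDim (A - B * X - X * Bᴴ) (leftKer B) ∧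
      negInertia (blockM₁ A B) = B.rank + posDim (-(A - B * X - X * Bᴴ)) (leftKer B) ∧
      (blockM₁ A B).rank = posInertia (blockM₁ A B) + negInertia (blockM₁ A B) := by
  have hM : (blockM₁ A B).IsHermitian :=
    Matrix.IsHermitian.fromBlocks hA rfl Matrix.isHermitian_zero
  have hform_eq : ∀ x ∈ leftKer B, hform A x x = hform (A - B * X - X * Bᴴ) x x := fun x hx => by
    have h1 : hform (B * X) x x = 0 := by
      rw [hform, ← Matrix.mulVec_mulVec, Matrix.dotProduct_mulVec,
        ← Matrix.conjTranspose_conjTranspose B, ← Matrix.star_mulVec, mem_leftKer.1 hx, star_zero,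
        zero_dotProduct]
    have h2 : hform (X * Bᴴ) x x = 0 := by
      rw [hform, ← Matrix.mulVec_mulVec, mem_leftKer.1 hx, Matrix.mulVec_zero, dotProduct_zero]
    rw [sub_eq_add_neg, sub_eq_add_neg, hform_matrix_add, hform_matrix_add, hform_neg, hform_neg,
      h1, h2]
    simp
  have hneg : -blockM₁ A B = Matrix.fromBlocks (-A) (-B) (-B)ᴴ 0 := by
    rw [blockM₁, Matrix.fromBlocks_neg, neg_zero, Matrix.conjTranspose_neg]
  have hker : leftKer (-B) = leftKer B := by
    ext x
    simp [mem_leftKer, Matrix.neg_mulVec]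
  have hrank : (-B).rank = B.rank := by
    have h1 := finrank_leftKer_add_rank B
    have h2 := finrank_leftKer_add_rank (-B)
    rw [hker] at h2
    omega
  obtain ⟨h1, h2⟩ := inertia_eq_posDim hM
  rw [rank_eq_posDim_add hM, h1, h2, hneg, posDim_fromBlocks hA.neg, blockM₁, posDim_fromBlocks hA,
    hker, hrank, posDim_congr hform_eq,
    posDim_congr (H := -A) (G := -(A - B * X - X * Bᴴ)) fun x hx => by
      rw [hform_neg, hform_neg, hform_eq x hx]]
  exact ⟨rfl, rfl, rfl⟩

theorem inertia_matM₃ (hA : A.IsHermitian) (hX : X.IsHermitian) (hS : B * X * Bᴴ = C) :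
    posInertia (matM₃ A B C) =
        posDim (A - B * X - X * Bᴴ) (LinearMap.range Bᴴ.mulVecLin) ∧
      negInertia (matM₃ A B C) =
        posDim (-(A - B * X - X * Bᴴ)) (LinearMap.range Bᴴ.mulVecLin) ∧
      (matM₃ A B C).rank = posInertia (matM₃ A B C) + negInertia (matM₃ A B C) := by
  have hM : matM₃ A B C = B * (A - B * X - X * Bᴴ) * Bᴴ := by
    rw [Matrix.mul_assoc, mul_conjTranspose_eq hS, matM₃, ← hS]
    noncomm_ring
  have hMh : (matM₃ A B C).IsHermitian := by
    rw [hM]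
    exact Matrix.isHermitian_mul_mul_conjTranspose B (isHermitian_sub_sub hA hX)
  obtain ⟨h1, h2⟩ := inertia_eq_posDim hMh
  have hneg : -matM₃ A B C = B * (-(A - B * X - X * Bᴴ)) * Bᴴ := by
    rw [hM, Matrix.mul_neg, Matrix.neg_mul]
  rw [rank_eq_posDim_add hMh, h1, h2, hneg, hM, posDim_mul_mul_conjTranspose,
    posDim_mul_mul_conjTranspose]
  exact ⟨rfl, rfl, rfl⟩

/-- The bounds that every Hermitian solution satisfies. -/
theorem inertia_bounds (hA : A.IsHermitian) (hC : C.IsHermitian)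
    (hX : X ∈ hermitianSolutions B C) :
    (A - B * X - X * Bᴴ).rank =
      posInertia (A - B * X - X * Bᴴ) + negInertia (A - B * X - X * Bᴴ) ∧
    (A - B * X - X * Bᴴ).rank + B.rank ≤ m + rowBlockRank (B ^ 2) (C - B * A) ∧
    posInertia (A - B * X - X * Bᴴ) ≤ posInertia (blockM₁ A B) ∧
    posInertia (A - B * X - X * Bᴴ) + B.rank ≤ m + posInertia (matM₃ A B C) ∧
    negInertia (A - B * X - X * Bᴴ) ≤ negInertia (blockM₁ A B) ∧
    negInertia (A - B * X - X * Bᴴ) + B.rank ≤ m + negInertia (matM₃ A B C) ∧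
    rowBlockRank (B ^ 2) (C - B * A) + posInertia (blockM₁ A B) ≤
      posInertia (A - B * X - X * Bᴴ) + (blockM₂ A B).rank ∧
    rowBlockRank (B ^ 2) (C - B * A) + posInertia (matM₃ A B C) ≤
      posInertia (A - B * X - X * Bᴴ) + rowBlockRank (B ^ 2) (C * Bᴴ - B * A * Bᴴ) ∧
    rowBlockRank (B ^ 2) (C - B * A) + negInertia (blockM₁ A B) ≤
      negInertia (A - B * X - X * Bᴴ) + (blockM₂ A B).rank ∧
    rowBlockRank (B ^ 2) (C - B * A) + negInertia (matM₃ A B C) ≤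
      negInertia (A - B * X - X * Bᴴ) + rowBlockRank (B ^ 2) (C * Bᴴ - B * A * Bᴴ) := by
  obtain ⟨hXh, hS⟩ := hX
  have hH := isHermitian_sub_sub (B := B) hA hXh
  have f1 := rowBlockRank_add_inf_perp_top hA hC hS
  have f2 := rank_blockM₂_add (B := B) (X := X) hA
  have f3 := rowBlockRank_add_inf_perp_range hA hC hS
  obtain ⟨f4, f5, -⟩ := inertia_blockM₁ (B := B) (X := X) hA
  obtain ⟨f6, f7, -⟩ := inertia_matM₃ hA hXh hS
  obtain ⟨f8, f9⟩ := inertia_eq_posDim hH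
  have f10 := rank_eq_posDim_add hH
  have f11 := finrank_leftKer_add_rank B
  have f12 : finrank ℂ (LinearMap.range Bᴴ.mulVecLin) = B.rank := B.rank_conjTranspose
  have g0 := finrank_ker_mulVecLin_add_rank (A - B * X - X * Bᴴ)
  rw [← perp_top] at g0
  generalize hHdef : A - B * X - X * Bᴴ = H at *
  set K₁ := leftKer B
  set K₂ := LinearMap.range Bᴴ.mulVecLin
  have g0' : finrank ℂ (K₁ ⊓ K₂ ⊓ perp H ⊤ : Submodule ℂ (Fin m → ℂ)) ≤ finrank ℂ (perp H ⊤) :=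
    Submodule.finrank_mono inf_le_right
  have g1 := posDim_top_add_finrank_le H K₁
  have g2 := posDim_top_add_finrank_le H K₂
  have g3 := posDim_top_add_finrank_le (-H) K₁
  have g4 := posDim_top_add_finrank_le (-H) K₂
  have g5 := posDim_add_finrank_le_top hH (K₀ := K₁ ⊓ K₂) (K := K₁) inf_le_left
  have g6 := posDim_add_finrank_le_top hH (K₀ := K₁ ⊓ K₂) (K := K₂) inf_le_right
  have g7 := posDim_add_finrank_le_top hH.neg (K₀ := K₁ ⊓ K₂) (K := K₁) inf_le_left
  have g8 := posDim_add_finrank_le_top hH.neg (K₀ := K₁ ⊓ K₂) (K := K₂) inf_le_right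
  rw [perp_neg, perp_neg] at g7 g8
  rw [Fintype.card_fin] at f11 g0 g1 g2 g3 g4
  refine ⟨?_, ?_, ?_, ?_, ?_, ?_, ?_, ?_, ?_, ?_⟩ <;> omega

/-- The witness is Y = X − FZ* − ZF*: since BF = 0, the correction disappears from BYB*, and only
BZF* and FZ*B* survive in BY + YB*. -/
theorem exists_mem_hermitianSolutions {F : Matrix (Fin m) (Fin m) ℂ} (hBF : B * F = 0)
    (hX : X ∈ hermitianSolutions B C) (Z : Matrix (Fin m) (Fin m) ℂ) :
    ∃ Y ∈ hermitianSolutions B C,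
      A - B * Y - Y * Bᴴ = A - B * X - X * Bᴴ + pert B F Z := by
  have hFB : Fᴴ * Bᴴ = 0 := by rw [← Matrix.conjTranspose_mul, hBF, Matrix.conjTranspose_zero]
  have e1 : B * (F * Zᴴ) = 0 := by rw [← Matrix.mul_assoc, hBF, Matrix.zero_mul]
  have e2 : Z * Fᴴ * Bᴴ = 0 := by rw [Matrix.mul_assoc, hFB, Matrix.mul_zero]
  refine ⟨X - F * Zᴴ - Z * Fᴴ, ⟨?_, ?_⟩, ?_⟩
  · simp only [Matrix.IsHermitian, Matrix.conjTranspose_sub, Matrix.conjTranspose_mul,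
      Matrix.conjTranspose_conjTranspose, hX.1.eq]
    abel
  · rw [Matrix.mul_sub, Matrix.mul_sub, Matrix.sub_mul, Matrix.sub_mul, hX.2, e1,
      Matrix.mul_assoc B, e2, Matrix.zero_mul, Matrix.mul_zero, sub_zero, sub_zero]
  · rw [Matrix.mul_sub, Matrix.mul_sub, Matrix.sub_mul, Matrix.sub_mul, e1, e2, pert,
      Matrix.mul_assoc B]
    abel

theorem exists_rank_ge (hA : A.IsHermitian) (hC : C.IsHermitian)
    (hX : X ∈ hermitianSolutions B C) :
    ∃ Y ∈ hermitianSolutions B C,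
      m + rowBlockRank (B ^ 2) (C - B * A) ≤ (A - B * Y - Y * Bᴴ).rank + B.rank ∨
      (blockM₁ A B).rank ≤ (A - B * Y - Y * Bᴴ).rank ∨
      2 * m + (matM₃ A B C).rank ≤ (A - B * Y - Y * Bᴴ).rank + 2 * B.rank := by
  obtain ⟨F, hBF, hF⟩ := exists_leftKer_eq_range B
  have hH := isHermitian_sub_sub (B := B) hA hX.1
  obtain ⟨Z, hZ⟩ := exists_rank_add_pert_ge B F hH
  obtain ⟨Y, hY, hYeq⟩ := exists_mem_hermitianSolutions (A := A) hBF hX Z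
  refine ⟨Y, hY, ?_⟩
  rw [hF, ← hYeq, Fintype.card_fin] at hZ
  have f1 := rowBlockRank_add_inf_perp_top hA hC hX.2
  obtain ⟨f4, f5, f5'⟩ := inertia_blockM₁ (B := B) (X := X) hA
  obtain ⟨f6, f7, f7'⟩ := inertia_matM₃ hA hX.1 hX.2
  have f11 := finrank_leftKer_add_rank B
  have f12 : finrank ℂ (LinearMap.range Bᴴ.mulVecLin) = B.rank := B.rank_conjTranspose
  have g1 := posDim_add_posDim_neg_add_finrank_radical hH (leftKer B)
  have g2 := posDim_add_posDim_neg_add_finrank_radical hH (LinearMap.range Bᴴ.mulVecLin)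
  rw [Fintype.card_fin] at f11
  rcases hZ with h | h | h
  · left; omega
  · right; left; omega
  · right; right; omega

theorem exists_posInertia_ge (hA : A.IsHermitian) (hX : X ∈ hermitianSolutions B C) :
    ∃ Y ∈ hermitianSolutions B C,
      posInertia (blockM₁ A B) ≤ posInertia (A - B * Y - Y * Bᴴ) ∨
      m + posInertia (matM₃ A B C) ≤ posInertia (A - B * Y - Y * Bᴴ) + B.rank := by
  obtain ⟨F, hBF, hF⟩ := exists_leftKer_eq_range B
  obtain ⟨Z, hZ⟩ := exists_posDim_add_pert_ge B F (isHermitian_sub_sub (B := B) hA hX.1)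
  obtain ⟨Y, hY, hYeq⟩ := exists_mem_hermitianSolutions (A := A) hBF hX Z
  refine ⟨Y, hY, ?_⟩
  rw [hF, ← hYeq, Fintype.card_fin] at hZ
  have f4 := (inertia_blockM₁ (B := B) (X := X) hA).1
  have f6 := (inertia_matM₃ hA hX.1 hX.2).1
  have f8 := (inertia_eq_posDim (isHermitian_sub_sub (B := B) hA hY.1)).1
  have f11 := finrank_leftKer_add_rank B
  have f12 : finrank ℂ (LinearMap.range Bᴴ.mulVecLin) = B.rank := B.rank_conjTranspose
  rw [Fintype.card_fin] at f11
  omega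

theorem exists_negInertia_ge (hA : A.IsHermitian) (hX : X ∈ hermitianSolutions B C) :
    ∃ Y ∈ hermitianSolutions B C,
      negInertia (blockM₁ A B) ≤ negInertia (A - B * Y - Y * Bᴴ) ∨
      m + negInertia (matM₃ A B C) ≤ negInertia (A - B * Y - Y * Bᴴ) + B.rank := by
  obtain ⟨F, hBF, hF⟩ := exists_leftKer_eq_range B
  obtain ⟨Z, hZ⟩ := exists_posDim_add_pert_ge B F (isHermitian_sub_sub (B := B) hA hX.1).neg
  obtain ⟨Y, hY, hYeq⟩ := exists_mem_hermitianSolutions (A := A) hBF hX (-Z)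
  refine ⟨Y, hY, ?_⟩
  -- The positive index of −H is maximised, so the perturbation of H itself is by −Z.
  have hneg : -(A - B * X - X * Bᴴ) + pert B F Z = -(A - B * Y - Y * Bᴴ) := by
    rw [hYeq, pert_neg]; abel
  rw [hF, hneg, Fintype.card_fin] at hZ
  have f5 := (inertia_blockM₁ (B := B) (X := X) hA).2.1
  have f7 := (inertia_matM₃ hA hX.1 hX.2).2.1
  have f8 := (inertia_eq_posDim (isHermitian_sub_sub (B := B) hA hY.1)).2
  have f11 := finrank_leftKer_add_rank B
  have f12 : finrank ℂ (LinearMap.range Bᴴ.mulVecLin) = B.rank := B.rank_conjTranspose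
  rw [Fintype.card_fin] at f11
  omega

/-- Both partial inertias can be minimised by the same solution. -/
theorem exists_inertia_le (hA : A.IsHermitian) (hC : C.IsHermitian)
    (hX : X ∈ hermitianSolutions B C) :
    ∃ Y ∈ hermitianSolutions B C,
      (posInertia (A - B * Y - Y * Bᴴ) + (blockM₂ A B).rank ≤
          rowBlockRank (B ^ 2) (C - B * A) + posInertia (blockM₁ A B) ∨
        posInertia (A - B * Y - Y * Bᴴ) + rowBlockRank (B ^ 2) (C * Bᴴ - B * A * Bᴴ) ≤
          rowBlockRank (B ^ 2) (C - B * A) + posInertia (matM₃ A B C)) ∧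
      (negInertia (A - B * Y - Y * Bᴴ) + (blockM₂ A B).rank ≤
          rowBlockRank (B ^ 2) (C - B * A) + negInertia (blockM₁ A B) ∨
        negInertia (A - B * Y - Y * Bᴴ) + rowBlockRank (B ^ 2) (C * Bᴴ - B * A * Bᴴ) ≤
          rowBlockRank (B ^ 2) (C - B * A) + negInertia (matM₃ A B C)) := by
  obtain ⟨F, hBF, hF⟩ := exists_leftKer_eq_range B
  obtain ⟨Z, hZ, hZ'⟩ := exists_posDim_add_pert_le B F (isHermitian_sub_sub (B := B) hA hX.1)
  obtain ⟨Y, hY, hYeq⟩ := exists_mem_hermitianSolutions (A := A) hBF hX Z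
  refine ⟨Y, hY, ?_⟩
  rw [hF, ← hYeq, le_max_iff] at hZ hZ'
  have f1 := rowBlockRank_add_inf_perp_top hA hC hX.2
  have f2 := rank_blockM₂_add (B := B) (X := X) hA
  have f3 := rowBlockRank_add_inf_perp_range hA hC hX.2
  obtain ⟨f4, f5, -⟩ := inertia_blockM₁ (B := B) (X := X) hA
  obtain ⟨f6, f7, -⟩ := inertia_matM₃ hA hX.1 hX.2
  obtain ⟨f8, f9⟩ := inertia_eq_posDim (isHermitian_sub_sub (B := B) hA hY.1)
  exact ⟨by omega, by omega⟩

end Main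

theorem mainTheorem7 (m : ℕ) (A B C : Matrix (Fin m) (Fin m) ℂ)
    (hA : A.IsHermitian) (hC : C.IsHermitian)
    (hS : (hermitianSolutions B C).Nonempty) :
    -- maximal rank
    IsGreatest
      ((fun X => ((A - B * X - X * Bᴴ).rank : ℤ)) '' hermitianSolutions B C)
      (min ((m : ℤ) + rowBlockRank (B ^ 2) (C - B * A) - B.rank)
        (min ((blockM₁ A B).rank : ℤ) (2 * (m : ℤ) - 2 * B.rank + (matM₃ A B C).rank))) ∧
    -- minimal rank
    IsLeast
      ((fun X => ((A - B * X - X * Bᴴ).rank : ℤ)) '' hermitianSolutions B C)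
      (max
        (max
          (2 * (rowBlockRank (B ^ 2) (C - B * A) : ℤ) + (blockM₁ A B).rank
            - 2 * (blockM₂ A B).rank)
          (2 * (rowBlockRank (B ^ 2) (C - B * A) : ℤ) + (matM₃ A B C).rank
            - 2 * rowBlockRank (B ^ 2) (B * A * Bᴴ - C * Bᴴ)))
        (max
          (2 * (rowBlockRank (B ^ 2) (C - B * A) : ℤ) + posInertia (blockM₁ A B)
            - (blockM₂ A B).rank + negInertia (matM₃ A B C)
            - rowBlockRank (B ^ 2) (C * Bᴴ - B * A * Bᴴ))
          (2 * (rowBlockRank (B ^ 2) (C - B * A) : ℤ) + negInertia (blockM₁ A B)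
            - (blockM₂ A B).rank + posInertia (matM₃ A B C)
            - rowBlockRank (B ^ 2) (C * Bᴴ - B * A * Bᴴ)))) ∧
    -- maximal partial inertias
    IsGreatest
      ((fun X => (posInertia (A - B * X - X * Bᴴ) : ℤ)) '' hermitianSolutions B C)
      (min (posInertia (blockM₁ A B) : ℤ)
        ((m : ℤ) - B.rank + posInertia (matM₃ A B C))) ∧
    IsGreatest
      ((fun X => (negInertia (A - B * X - X * Bᴴ) : ℤ)) '' hermitianSolutions B C)
      (min (negInertia (blockM₁ A B) : ℤ)
        ((m : ℤ) - B.rank + negInertia (matM₃ A B C))) ∧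
    -- minimal partial inertias
    IsLeast
      ((fun X => (posInertia (A - B * X - X * Bᴴ) : ℤ)) '' hermitianSolutions B C)
      ((rowBlockRank (B ^ 2) (C - B * A) : ℤ) +
        max ((posInertia (blockM₁ A B) : ℤ) - (blockM₂ A B).rank)
          ((posInertia (matM₃ A B C) : ℤ)
            - rowBlockRank (B ^ 2) (C * Bᴴ - B * A * Bᴴ))) ∧
    IsLeast
      ((fun X => (negInertia (A - B * X - X * Bᴴ) : ℤ)) '' hermitianSolutions B C)
      ((rowBlockRank (B ^ 2) (C - B * A) : ℤ) +
        max ((negInertia (blockM₁ A B) : ℤ) - (blockM₂ A B).rank)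
          ((negInertia (matM₃ A B C) : ℤ)
            - rowBlockRank (B ^ 2) (C * Bᴴ - B * A * Bᴴ))) := by
  obtain ⟨X, hX⟩ := hS
  have hσ : rowBlockRank (B ^ 2) (B * A * Bᴴ - C * Bᴴ) =
      rowBlockRank (B ^ 2) (C * Bᴴ - B * A * Bᴴ) := by
    rw [← rowBlockRank_neg, neg_sub]
  have hr₁ := (inertia_blockM₁ (B := B) (X := X) hA).2.2
  have hr₃ := (inertia_matM₃ hA hX.1 hX.2).2.2
  rw [hσ]
  refine ⟨⟨?_, ?_⟩, ⟨?_, ?_⟩, ⟨?_, ?_⟩, ⟨?_, ?_⟩, ⟨?_, ?_⟩, ⟨?_, ?_⟩⟩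
  · obtain ⟨Y, hY, h⟩ := exists_rank_ge hA hC hX
    refine ⟨Y, hY, ?_⟩
    have := inertia_bounds hA hC hY
    dsimp only
    omega
  · rintro _ ⟨Y, hY, rfl⟩
    have := inertia_bounds hA hC hY
    dsimp only
    omega
  -- One Y minimises both partial indices, so the minimal rank is a sum of two maxima of two terms
  -- each; expanding it gives s₁, …, s₄.
  · obtain ⟨Y, hY, h⟩ := exists_inertia_le hA hC hX
    refine ⟨Y, hY, ?_⟩
    have := inertia_bounds hA hC hY
    dsimp only
    omega
  · rintro _ ⟨Y, hY, rfl⟩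
    have := inertia_bounds hA hC hY
    dsimp only
    omega
  · obtain ⟨Y, hY, h⟩ := exists_posInertia_ge hA hX
    refine ⟨Y, hY, ?_⟩
    have := inertia_bounds hA hC hY
    dsimp only
    omega
  · rintro _ ⟨Y, hY, rfl⟩
    have := inertia_bounds hA hC hY
    dsimp only
    omega
  · obtain ⟨Y, hY, h⟩ := exists_negInertia_ge hA hX
    refine ⟨Y, hY, ?_⟩
    have := inertia_bounds hA hC hY
    dsimp only
    omega
  · rintro _ ⟨Y, hY, rfl⟩
    have := inertia_bounds hA hC hY
    dsimp only
    omega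
  · obtain ⟨Y, hY, h⟩ := exists_inertia_le hA hC hX
    refine ⟨Y, hY, ?_⟩
    have := inertia_bounds hA hC hY
    dsimp only
    omega
  · rintro _ ⟨Y, hY, rfl⟩
    have := inertia_bounds hA hC hY
    dsimp only
    omega
  · obtain ⟨Y, hY, h⟩ := exists_inertia_le hA hC hX
    refine ⟨Y, hY, ?_⟩
    have := inertia_bounds hA hC hY
    dsimp only
    omega
  · rintro _ ⟨Y, hY, rfl⟩
    have := inertia_bounds hA hC hY
    dsimp only
    omega
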